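/- Let $q$ be a prime power, $A=\mathbb{F}_q[\theta]$, $K=\mathbb{F}_q(\theta)$ with $|x|_\infty=q^{\deg x}$, $K_\infty$ its completion, $\mathbb{C}_\infty$ the completion of an algebraic closure of $K_\infty$, and $\mathbb{K}\subseteq\mathbb{C}_\infty$ an algebraically closed field containing $K$ (for example the algebraic closure $\overline{K}$ of $K$ in $\mathbb{C}_\infty$). For $f=\sum_i a_it^i\in\mathbb{C}_\infty((t))$ and $n\in\mathbb{Z}$ put $f^{(n)}=\sum_i a_i^{q^n}t^i$ (entrywise for matrices and vectors), let $\partial_t^n f=\sum_i\binom{i}{n}a_it^{i-n}$ be the hyperderivatives, and let $\mathbb{T}_\theta=\{\sum_{i\ge0}b_it^i : |b_i\theta^i|_\infty\to0\}$. For a polynomial $Q$, $\|Q\|_1$ is the maximum of the absolute values of its coefficients. Let $r\ge1$, let $s_1,\dots,s_r\ge1$ be integers, $d_i=s_i+\cdots+s_r$, $d=d_1+\cdots+d_r$, and let $Q_1,\dots,Q_{r-1}\in\mathbb{K}[t]$. Let $\Phi'\in\mathrm{Mat}_r(\mathbb{K}[t])$ be the matrix with diagonal entries $\Phi'_{i,i}=(t-\theta)^{d_i}$,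 subdiagonal entries $\Phi'_{i+1,i}=Q_i^{(-1)}(t-\theta)^{d_i}$, and zeros elsewhere. Let $M'=\mathrm{Mat}_{1\times r}(\mathbb{K}[t])$ with standard $\mathbb{K}[t]$-basis $m_1,\dots,m_r$ and with $\sigma a=a^{(-1)}\Phi'$; it is free over $\mathbb{K}[\sigma]$ (where $\sigma x=x^{1/q}\sigma$ for $x\in\mathbb{K}$) with basis $(e_1,\dots,e_d)=\big((t-\theta)^{d_1-1}m_1,\dots,m_1,\dots,(t-\theta)^{d_r-1}m_r,\dots,m_r\big)$. Let $\Delta:M'\to\mathbb{K}^d$ be the map $\sum_{l,n}x_{l,n}\sigma^ne_l\mapsto\big(\sum_n x_{l,n}^{q^n}\big)_l$ with $x_{l,n}\in\mathbb{K}$, which induces $M'/(\sigma-1)M'\cong\mathbb{K}^d$, and let $G=(\mathbb{G}_a^d,\rho)$ be the $t$-module over $\mathbb{K}$ with $\rho(t)\Delta(m)=\Delta(tm)$ for $m\in M'$. Its exponential is $\mathrm{Exp}_G(\mathbf{z})=\sum_{i\ge0}E_i\mathbf{z}^{(i)}$, where the matrices $E_i\in\mathrm{Mat}_d(\mathbb{K})$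 are determined by $E_0=I_d$ and $\mathrm{Exp}_G\circ\partial\rho(t)=\rho(t)\circ\mathrm{Exp}_G$ ($\partial\rho(t)$ being the constant term of $\rho(t)\in\mathrm{Mat}_d(\mathbb{K})[\tau]$). Put $\Theta=(\Phi'^{-1})^{\mathrm{tr}}$, let $X$ be the block diagonal $r\times d$ matrix with diagonal blocks $\mathbf{x}_i=\big((t-\theta)^{d_i-1},\dots,t-\theta,1\big)$, and let $D$ be the operator that sends an $r\times d$ matrix with rows $\mathbf{a}_1,\dots,\mathbf{a}_r$ to the $d\times d$ matrix with rows $\partial_t^{d_1-1}\mathbf{a}_1,\dots,\partial_t^{1}\mathbf{a}_1,\mathbf{a}_1,\dots,\partial_t^{d_r-1}\mathbf{a}_r,\dots,\partial_t^1\mathbf{a}_r,\mathbf{a}_r$. **Lemma.** Assume $\|Q_i\|_1\le q^{s_iq/(q-1)}$ for $1\le i\le r-1$, and let $\mathbf{c}=(c_{1,1},\dots,c_{1,d_1},\dots,c_{r,1},\dots,c_{r,d_r})^{\mathrm{tr}}\in\mathbb{C}_\infty^d$ satisfy $|c_{i,j}|_\infty<q^{\,j+d_i/(q-1)}$ for $1\le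 i\le r$, $1\le j\le d_i$. Then for every $n\ge0$ the entries of $D\big((\Theta^{(1)}\cdots\Theta^{(n)})X^{(n)}\big)$ lie in $\mathbb{T}_\theta$, the series $$\mathbf{Y}=\sum_{n=0}^{\infty}D\Big(\big(\Theta^{(1)}\Theta^{(2)}\cdots\Theta^{(n)}\big)X^{(n)}\Big)\Big|_{t=\theta}\,\mathbf{c}^{(n)}$$ converges in $\mathbb{C}_\infty^d$, the series $\mathrm{Exp}_G(\mathbf{Y})$ converges, and $$\mathrm{Exp}_G(\mathbf{Y})=\mathbf{c}.$$ -/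

import Mathlib

open Polynomial

namespace TMot

section Fields

/-! ### The field `ℂ_∞` -/

variable (Fq : Type*) [Field Fq] [Fintype Fq]

open scoped Classical in
/-- The absolute value `|x|_∞ = q ^ (-ord_∞ x) = q ^ (deg x)` on `K = 𝔽_q(θ)`. -/
noncomputable def absInfty : AbsoluteValue (RatFunc Fq) ℝ where
  toFun x := if x = 0 then 0 else (Fintype.card Fq : ℝ) ^ x.intDegree
  map_mul' x y := by
    have hq : (Fintype.card Fq : ℝ) ≠ 0 := by exact_mod_cast Fintype.card_ne_zero
    by_cases hx : x = 0
    · simp [hx]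
    by_cases hy : y = 0
    · simp [hy]
    simp [hx, hy, RatFunc.intDegree_mul hx hy, zpow_add₀ hq]
  nonneg' x := by split_ifs <;> positivity
  eq_zero' x := by
    have hq : (Fintype.card Fq : ℝ) ≠ 0 := by exact_mod_cast Fintype.card_ne_zero
    by_cases hx : x = 0
    · simp [hx]
    · simp [hx, zpow_ne_zero _ hq]
  add_le' x y := by
    have hq : (1 : ℝ) ≤ Fintype.card Fq := by exact_mod_cast Fintype.card_pos
    have h0 (z : RatFunc Fq) : (0 : ℝ) ≤ if z = 0 then 0 else (Fintype.card Fq : ℝ) ^ z.intDegree := by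
      split_ifs <;> positivity
    by_cases hx : x = 0
    · simp [hx]
    by_cases hy : y = 0
    · simp [hy]
    by_cases hxy : x + y = 0
    · simpa [hxy] using add_nonneg (h0 x) (h0 y)
    simp only [hx, hy, hxy, if_false]
    rcases le_max_iff.1 (RatFunc.intDegree_add_le hy hxy) with h | h
    · exact (zpow_le_zpow_right₀ hq h).trans (le_add_of_nonneg_right (by positivity))
    · exact (zpow_le_zpow_right₀ hq h).trans (le_add_of_nonneg_left (by positivity))

theorem absInfty_add_le_max (x y : RatFunc Fq) :
    absInfty Fq (x + y) ≤ max (absInfty Fq x) (absInfty Fq y) := by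
  classical
  have hq : (1 : ℝ) ≤ Fintype.card Fq := by exact_mod_cast Fintype.card_pos
  by_cases hx : x = 0
  · simp [hx]
  by_cases hy : y = 0
  · simp [hy]
  by_cases hxy : x + y = 0
  · simp [hxy]
  simp only [absInfty, AbsoluteValue.coe_mk, MulHom.coe_mk, hx, hy, hxy, if_false]
  rcases le_max_iff.1 (RatFunc.intDegree_add_le hy hxy) with h | h
  · exact le_max_of_le_left (zpow_le_zpow_right₀ hq h)
  · exact le_max_of_le_right (zpow_le_zpow_right₀ hq h)

theorem absInfty_X :
    absInfty Fq RatFunc.X = Fintype.card Fq := by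
  simp [absInfty, RatFunc.X_ne_zero]

/-- `K_∞ = 𝔽_q((1/θ))`, the completion of `K = 𝔽_q(θ)` at the infinite place. -/
abbrev KInfty := (absInfty Fq).Completion


instance KInfty.instUltra : IsUltrametricDist (KInfty Fq) := by
  apply IsUltrametricDist.isUltrametricDist_of_forall_norm_add_le_max_norm
  intro x y
  induction x, y using UniformSpace.Completion.induction_on₂ with
  | hp => exact isClosed_le (by fun_prop) (by fun_prop)
  | ih a b =>
    rw [← UniformSpace.Completion.coe_add]
    simp only [UniformSpace.Completion.norm_coe]
    exact absInfty_add_le_max Fq a.ofAbs b.ofAbs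

theorem KInfty.norm_algebraMap (x : RatFunc Fq) :
    ‖algebraMap (RatFunc Fq) (KInfty Fq) x‖ = absInfty Fq x := by
  change ‖((WithAbs.toAbs (absInfty Fq) x : WithAbs (absInfty Fq)) : KInfty Fq)‖ = _
  rw [UniformSpace.Completion.norm_coe]
  rfl
noncomputable instance : NontriviallyNormedField (KInfty Fq) where
  non_trivial := by
    refine ⟨algebraMap (RatFunc Fq) _ RatFunc.X, ?_⟩
    rw [KInfty.norm_algebraMap, absInfty_X]
    exact_mod_cast Fintype.one_lt_card

/-- An algebraic closure of `K_∞`. -/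
abbrev KInftyBar := AlgebraicClosure (KInfty Fq)

/-- The unique extension of `|·|_∞` to the algebraic closure of `K_∞`. -/
noncomputable instance : NormedField (KInftyBar Fq) :=
  spectralNorm.normedField (KInfty Fq) (KInftyBar Fq)
noncomputable instance : NormedAlgebra (KInfty Fq) (KInftyBar Fq) :=
  spectralNorm.normedAlgebra (KInfty Fq) (KInftyBar Fq)

/-- `ℂ_∞`, the completion of the algebraic closure of `K_∞`. -/
abbrev CInfty := UniformSpace.Completion (KInftyBar Fq)


noncomputable instance : Algebra (RatFunc Fq) (CInfty Fq) :=
  ((algebraMap (KInfty Fq) (CInfty Fq)).comp (algebraMap (RatFunc Fq) (KInfty Fq))).toAlgebra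

end Fields

section TModules

/-! ### `t`-modules and their exponential maps -/

variable (Fq : Type*) [Field Fq] [Fintype Fq] (F : Type*) [Field F] [Algebra (RatFunc Fq) F]

/-- `θ`, viewed in a field `F` containing `K = 𝔽_q(θ)`. -/
noncomputable def theta : F := algebraMap (RatFunc Fq) F RatFunc.X

theorem add_pow_card_pow (n : ℕ) (x y : F) :
    (x + y) ^ (Fintype.card Fq ^ n) = x ^ (Fintype.card Fq ^ n) + y ^ (Fintype.card Fq ^ n) := by
  obtain ⟨p, hp⟩ := CharP.exists Fq
  obtain ⟨m, hpp, hm⟩ := FiniteField.card Fq p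
  have : Fact p.Prime := ⟨hpp⟩
  have : CharP F p :=
    charP_of_injective_ringHom
      ((algebraMap (RatFunc Fq) F).comp (algebraMap Fq (RatFunc Fq))).injective p
  rw [hm, ← pow_mul, add_pow_char_pow]

/-- The `n`-fold Frobenius `x ↦ x ^ (q ^ n)`, for `n ≥ 0`. -/
def frob (n : ℕ) : F →+* F where
  toFun x := x ^ (Fintype.card Fq ^ n)
  map_one' := one_pow _
  map_mul' x y := mul_pow x y _
  map_zero' := zero_pow (pow_ne_zero _ Fintype.card_ne_zero)
  map_add' := add_pow_card_pow Fq F n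

@[simp] theorem frob_apply (n : ℕ) (x : F) : frob Fq F n x = x ^ (Fintype.card Fq ^ n) := rfl

/-- The automorphism `x ↦ x ^ q` of an algebraically closed field `F ⊇ K`. -/
noncomputable def frobEquiv [IsAlgClosed F] : F ≃+* F :=
  RingEquiv.ofBijective (frob Fq F 1) ⟨(frob Fq F 1).injective, fun y => by
    obtain ⟨z, hz⟩ := IsAlgClosed.exists_pow_nat_eq y (n := Fintype.card Fq) Fintype.card_pos
    exact ⟨z, by simpa using hz⟩⟩

theorem theta_pow_ne (n : ℕ) (hn : n ≠ 0) : theta Fq F ^ (Fintype.card Fq ^ n) ≠ theta Fq F := by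
  have h1 : 1 < Fintype.card Fq ^ n := Nat.one_lt_pow hn Fintype.one_lt_card
  intro h
  unfold theta at h
  rw [← map_pow] at h
  have h2 := (algebraMap (RatFunc Fq) F).injective h
  rw [← RatFunc.algebraMap_X, ← map_pow] at h2
  have h3 := RatFunc.algebraMap_injective Fq h2
  have := congrArg Polynomial.natDegree h3
  simp only [natDegree_X_pow, natDegree_X] at this
  omega

/-- A `t`-module over `F` with coordinates indexed by `n`. An `𝔽_q`-linear ring homomorphism
`ρ : 𝔽_q[t] → Mat_n(F)[τ]` is the same thing as its value `ρ(t) = ∑ᵢ αᵢ τ ^ i`, which is recorded by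
its coefficients `αᵢ`; the matrix `∂ρ(t) - θ` has to be nilpotent. -/
structure TModule (n : Type*) [Fintype n] [DecidableEq n] where
  /-- The coefficients of `ρ(t) ∈ Mat_n(F)[τ]`. -/
  rhoT : ℕ →₀ Matrix n n F
  nilpotent : IsNilpotent (rhoT 0 - theta Fq F • (1 : Matrix n n F))

namespace TModule
variable {Fq F} {n : Type*} [Fintype n] [DecidableEq n] (G : TModule Fq F n)

/-- The action of `ρ(t)` on the `F`-valued points: `z ↦ ∑ᵢ αᵢ z^{(i)}`. -/
def act (z : n → F) : n → F :=
  ∑ i ∈ G.rhoT.support, (G.rhoT i).mulVec fun l => z l ^ (Fintype.card Fq ^ i)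

/-- `e` is the sequence of coefficients of `Exp_G(z) = ∑ᵢ eᵢ z^{(i)}`: `e₀ = 1`, and the functional
equation `Exp_G ∘ ∂ρ(t) = ρ(t) ∘ Exp_G` holds as an identity of power series. (It then holds with
any `a ∈ 𝔽_q[t]` in place of `t`, as `t` generates `𝔽_q[t]` over `𝔽_q`.) -/
def IsExpCoeff (e : ℕ → Matrix n n F) : Prop :=
  e 0 = 1 ∧ ∀ m, e m * (G.rhoT 0).map (frob Fq F m) =
    ∑ i ∈ Finset.range (m + 1), G.rhoT i * (e (m - i)).map (frob Fq F i)

theorem sylvester_bijective (m : ℕ) (hm : m ≠ 0) : Function.Bijective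
    (fun E : Matrix n n F => E * (G.rhoT 0).map (frob Fq F m) - G.rhoT 0 * E) := by
  set A := G.rhoT 0 with hA
  set N := A - theta Fq F • (1 : Matrix n n F) with hN
  have hAN : A = theta Fq F • (1 : Matrix n n F) + N := by rw [hN]; abel
  have hNil : IsNilpotent N := G.nilpotent
  set f := frob Fq F m
  have hmap : A.map f = f (theta Fq F) • (1 : Matrix n n F) + N.map f := by
    rw [hAN, Matrix.map_add _ (map_add f)]
    congr 1
    ext i j
    by_cases h : i = j <;> simp [h]
  have hNil' : IsNilpotent (N.map f) := by
    have := hNil.map f.mapMatrix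
    simpa using this
  let L : Module.End F (Matrix n n F) := LinearMap.mulLeft F N
  let R : Module.End F (Matrix n n F) := LinearMap.mulRight F (N.map f)
  have hL : IsNilpotent L := (LinearMap.isNilpotent_mulLeft_iff F N).2 hNil
  have hR : IsNilpotent R := (LinearMap.isNilpotent_mulRight_iff F _).2 hNil'
  have hc : Commute R L := by
    show R * L = L * R
    ext1 x
    simp [L, R, mul_assoc]
  have hRL : IsNilpotent (R - L) := hc.isNilpotent_sub hR hL
  have hu : IsUnit (algebraMap F (Module.End F (Matrix n n F)) (f (theta Fq F) - theta Fq F)) :=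
    (IsUnit.mk0 _ (sub_ne_zero.2 (theta_pow_ne Fq F m hm))).map _
  have hU := hRL.isUnit_add_left_of_commute hu (Algebra.commutes _ _).symm
  have := (Module.End.isUnit_iff _).1 hU
  convert this using 1
  ext1 E
  rw [hmap]
  conv_lhs => rw [hAN]
  simp [L, R, mul_add, add_mul, Module.algebraMap_end_apply]
  abel

theorem isExpCoeff_iff_succ (e : ℕ → Matrix n n F) (m : ℕ) :
    (e m * (G.rhoT 0).map (frob Fq F m) =
      ∑ i ∈ Finset.range (m + 1), G.rhoT i * (e (m - i)).map (frob Fq F i)) ↔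
    e m * (G.rhoT 0).map (frob Fq F m) - G.rhoT 0 * e m =
      ∑ i : Fin m, G.rhoT (m - i) * (e i).map (frob Fq F (m - i)) := by
  have h1 : ∑ i ∈ Finset.range (m + 1), G.rhoT i * (e (m - i)).map (frob Fq F i) =
      (∑ i : Fin m, G.rhoT (m - i) * (e i).map (frob Fq F (m - i))) + G.rhoT 0 * e m := by
    rw [← Finset.sum_range_reflect, Finset.sum_range_succ,
      Fin.sum_univ_eq_sum_range (fun i => G.rhoT (m - i) * (e i).map (frob Fq F (m - i)))]
    congr 1
    · refine Finset.sum_congr rfl fun i hi => ?_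
      have hi' := Finset.mem_range.1 hi
      rw [show m + 1 - 1 - i = m - i by omega, show m - (m - i) = i by omega]
    rw [show m + 1 - 1 - m = 0 by omega, Nat.sub_zero]
    congr 1
    ext i j
    simp
  rw [h1, sub_eq_iff_eq_add]

theorem existsUnique_expCoeff : ∃! e : ℕ → Matrix n n F, G.IsExpCoeff e := by
  let S (m : ℕ) (E : Matrix n n F) := E * (G.rhoT 0).map (frob Fq F m) - G.rhoT 0 * E
  let step (m : ℕ) (prev : (k : ℕ) → k < m → Matrix n n F) : Matrix n n F :=
    if hm : m = 0 then 1 else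
      ((G.sylvester_bijective m hm).2
        (∑ i : Fin m, G.rhoT (m - i) * (prev i i.2).map (frob Fq F (m - i)))).choose
  let e : ℕ → Matrix n n F := WellFoundedLT.fix step
  have he (m : ℕ) : e m = step m (fun k _ => e k) := WellFoundedLT.fix_eq step m
  refine ⟨e, ⟨by rw [he]; simp [step], fun m => ?_⟩, fun e' he' => ?_⟩
  · by_cases hm : m = 0
    · subst hm
      have h0 : e 0 = 1 := by rw [he]; simp [step]
      rw [h0]
      simp only [zero_add, Finset.range_one, Finset.sum_singleton, Nat.sub_zero, h0, one_mul]
      ext i j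
      simp [Matrix.map_one]
    · rw [isExpCoeff_iff_succ G e m]
      have := ((G.sylvester_bijective m hm).2
        (∑ i : Fin m, G.rhoT (m - i) * (e i).map (frob Fq F (m - i)))).choose_spec
      have h2 : e m = ((G.sylvester_bijective m hm).2
        (∑ i : Fin m, G.rhoT (m - i) * (e i).map (frob Fq F (m - i)))).choose := by
        rw [he]; simp only [step, dif_neg hm]
      rw [h2]
      exact this
  · funext m
    induction m using Nat.strong_induction_on with
    | _ m ih =>
      by_cases hm : m = 0
      · subst hm
        rw [he'.1, he]; simp [step]
      · have h1 := (isExpCoeff_iff_succ G e' m).1 (he'.2 m)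
        have h2 := ((G.sylvester_bijective m hm).2
          (∑ i : Fin m, G.rhoT (m - i) * (e i).map (frob Fq F (m - i)))).choose_spec
        apply (G.sylvester_bijective m hm).1
        have h3 : e m = ((G.sylvester_bijective m hm).2
          (∑ i : Fin m, G.rhoT (m - i) * (e i).map (frob Fq F (m - i)))).choose := by
          rw [he]; simp only [step, dif_neg hm]
        rw [h3]
        refine h1.trans (Eq.trans ?_ h2.symm)
        exact Finset.sum_congr rfl fun i _ => by rw [ih i i.2]

/-- The coefficients `eᵢ` of the exponential map of `G`. -/
noncomputable def expCoeff : ℕ → Matrix n n F := G.existsUnique_expCoeff.choose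

theorem isExpCoeff_expCoeff : G.IsExpCoeff G.expCoeff := G.existsUnique_expCoeff.choose_spec.1

/-- The `i`-th term `eᵢ z^{(i)}` of the exponential series at `z ∈ Lie G(C)`, for `C ⊇ F`. -/
noncomputable def expTerm {C : Type*} [Field C] [Algebra F C] (z : n → C) (i : ℕ) : n → C :=
  ((G.expCoeff i).map (algebraMap F C)).mulVec fun l => z l ^ (Fintype.card Fq ^ i)

/-- The exponential map `Exp_G : Lie G(C) → G(C)`, `z ↦ ∑ᵢ eᵢ z^{(i)}`. -/
noncomputable def Exp {C : Type*} [Field C] [TopologicalSpace C] [Algebra F C] (z : n → C) :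
    n → C := ∑' i, G.expTerm z i

end TModule

section DualMotive

/-! ### The dual `t`-motive `M'` and its `t`-module

The depth is `r = k + 1`, and indices start at `0`. -/

variable [IsAlgClosed F] {k : ℕ} (s : Fin (k + 1) → ℕ+)

/-- `dᵢ = sᵢ + ⋯ + s_r`. -/
def dSum (i : Fin (k + 1)) : ℕ := ∑ j ∈ Finset.Ici i, (s j : ℕ)

theorem dSum_pos (i : Fin (k + 1)) : 0 < dSum s i :=
  Finset.sum_pos (fun j _ => (s j).pos) ⟨i, Finset.mem_Ici.2 le_rfl⟩

/-- The index set of the `d = d₁ + ⋯ + d_r` coordinates: the pair `⟨i, j⟩` stands for the coordinate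
`j + 1` of the block `i`. -/
abbrev Idx := Σ i : Fin (k + 1), Fin (dSum s i)

variable (Q : Fin k → F[X])

/-- The twist `f^{(-1)}` of a polynomial: `q`-th roots are taken of all its coefficients. -/
noncomputable def rootTwist (f : F[X]) : F[X] := f.map (frobEquiv Fq F).symm.toRingHom

/-- The matrix `Φ'`, with `(t - θ) ^ dᵢ` on the diagonal, `Qᵢ^{(-1)} (t - θ) ^ dᵢ` in row `i + 1` and
column `i`, and zeros elsewhere. -/
noncomputable def PhiPrime : Matrix (Fin (k + 1)) (Fin (k + 1)) F[X] := Matrix.of fun i j =>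
  if i = j then (X - C (theta Fq F)) ^ dSum s i
  else if h : (j : ℕ) + 1 = i then
    rootTwist Fq F (Q ⟨j, by omega⟩) * (X - C (theta Fq F)) ^ dSum s j
  else 0

/-- `σ` on `M' = Mat_{1 × r}(F[t])`, given by `σ a = a^{(-1)} Φ'`. -/
noncomputable def sigma (a : Fin (k + 1) → F[X]) : Fin (k + 1) → F[X] :=
  Matrix.vecMul (fun i => rootTwist Fq F (a i)) (PhiPrime Fq F s Q)

/-- The `F[σ]`-basis `(t - θ) ^ (dᵢ - 1) mᵢ, …, mᵢ` (`1 ≤ i ≤ r`) of `M'`. -/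
noncomputable def sigmaBasis (l : Idx s) : Fin (k + 1) → F[X] :=
  Pi.single l.1 ((X - C (theta Fq F)) ^ (dSum s l.1 - 1 - l.2))

/-- The element `∑ₗ bₗ eₗ` of `M'` for `b ∈ Mat_{1 × d}(F[σ])`; the entry `bₗ = ∑ₙ cₙ σ ^ n` is given
by its coefficients `cₙ`. -/
noncomputable def sigmaComb (b : Idx s → ℕ →₀ F) : Fin (k + 1) → F[X] :=
  ∑ l, (b l).sum fun n c => c • (sigma Fq F s Q)^[n] (sigmaBasis Fq F s l)

/-- `t - θ`. -/
noncomputable abbrev tSubTheta : F[X] := X - C (theta Fq F)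

/-- `Q_j^{(-1)}`, and `0` for the last index. -/
noncomputable def Qroot (j : Fin (k + 1)) : F[X] := 
  if h : (j : ℕ) < k then rootTwist Fq F (Q ⟨j, h⟩) else 0

/-- The entry after the `j`-th one, and `0` for the last index. -/
noncomputable def nextEntry {α} [Zero α] (a : Fin (k + 1) → α) (j : Fin (k + 1)) : α :=
  if h : (j : ℕ) < k then a ⟨j + 1, by omega⟩ else 0

theorem rootTwist_add (f g : F[X]) :
    rootTwist Fq F (f + g) = rootTwist Fq F f + rootTwist Fq F g := Polynomial.map_add _
theorem rootTwist_mul (f g : F[X]) :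
    rootTwist Fq F (f * g) = rootTwist Fq F f * rootTwist Fq F g := Polynomial.map_mul _
theorem rootTwist_injective : Function.Injective (rootTwist Fq F) :=
  Polynomial.map_injective _ (frobEquiv Fq F).symm.injective
theorem rootTwist_map (f : F[X]) :
    rootTwist Fq F (f.map (frobEquiv Fq F).toRingHom) = f := by
  ext n; simp [rootTwist]

theorem vecMul_PhiPrime (x : Fin (k + 1) → F[X]) (j : Fin (k + 1)) :
    Matrix.vecMul x (PhiPrime Fq F s Q) j = tSubTheta Fq F ^ dSum s j * (x j + Qroot Fq F Q j * nextEntry x j) := by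
  simp only [Matrix.vecMul, dotProduct, PhiPrime, Matrix.of_apply]
  by_cases hj : (j : ℕ) < k
  · have hne : j ≠ ⟨j + 1, by omega⟩ := fun h => by simp [Fin.ext_iff] at h
    rw [Finset.sum_eq_add j ⟨j + 1, by omega⟩ hne]
    · simp [hne.symm, Qroot, nextEntry, hj]; ring
    · intro c _ hc
      rw [if_neg hc.1, dif_neg, mul_zero]
      intro h
      exact hc.2 (Fin.ext h.symm)
    · simp
    · simp
  · rw [Finset.sum_eq_single j]
    · simp [Qroot, hj]; ring
    · intro c _ hc
      rw [if_neg hc, dif_neg, mul_zero]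
      omega
    · simp

theorem sigma_apply (a : Fin (k + 1) → F[X]) (j : Fin (k + 1)) :
    sigma Fq F s Q a j = tSubTheta Fq F ^ dSum s j *
      (rootTwist Fq F (a j) + Qroot Fq F Q j * nextEntry (fun i => rootTwist Fq F (a i)) j) :=
  vecMul_PhiPrime Fq F s Q _ j

theorem sigma_add (a b : Fin (k + 1) → F[X]) :
    sigma Fq F s Q (a + b) = sigma Fq F s Q a + sigma Fq F s Q b := by
  unfold sigma
  rw [← Matrix.add_vecMul]
  congr 1
  ext1 i
  exact rootTwist_add _ _ _ _

/-- `σ` as an additive map. -/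
noncomputable def sigmaHom : (Fin (k + 1) → F[X]) →+ (Fin (k + 1) → F[X]) :=
  AddMonoidHom.mk' (sigma Fq F s Q) (sigma_add Fq F s Q)

theorem sigma_smul (c : F) (a : Fin (k + 1) → F[X]) :
    sigma Fq F s Q (c • a) = (frobEquiv Fq F).symm c • sigma Fq F s Q a := by
  unfold sigma
  rw [← Matrix.smul_vecMul]
  congr 1
  ext1 i
  simp [rootTwist, Polynomial.smul_eq_C_mul]

theorem sigma_injective : Function.Injective (sigma Fq F s Q) := by
  rw [show sigma Fq F s Q = sigmaHom Fq F s Q from rfl, injective_iff_map_eq_zero]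
  intro a ha
  have h0 : ∀ j, rootTwist Fq F (a j) + Qroot Fq F Q j *
      nextEntry (fun i => rootTwist Fq F (a i)) j = 0 := fun j => by
    have := congrFun ha j
    rw [show sigmaHom Fq F s Q a = sigma Fq F s Q a from rfl, sigma_apply] at this
    exact (mul_eq_zero.1 this).resolve_left (pow_ne_zero _ (X_sub_C_ne_zero _))
  have h1 : ∀ j, rootTwist Fq F (a j) = 0 := by
    intro j
    induction j using Fin.reverseInduction with
    | last => simpa [Qroot] using h0 (Fin.last k)
    | cast i ih =>
      have := h0 i.castSucc
      have hn : nextEntry (fun i => rootTwist Fq F (a i)) i.castSucc = 0 := by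
        simp only [nextEntry, Fin.val_castSucc, i.2, dif_pos]
        exact ih
      rwa [hn, mul_zero, add_zero] at this
  funext j
  apply rootTwist_injective Fq F
  rw [h1 j]; simp [rootTwist]

theorem sigma_pow_smul (n : ℕ) (c : F) (a : Fin (k + 1) → F[X]) :
    sigma Fq F s Q (c • (sigma Fq F s Q)^[n] a) =
      (frobEquiv Fq F).symm c • (sigma Fq F s Q)^[n + 1] a := by
  rw [sigma_smul, Function.iterate_succ_apply']

theorem sigmaComb_add (b b' : Idx s → ℕ →₀ F) :
    sigmaComb Fq F s Q (b + b') = sigmaComb Fq F s Q b + sigmaComb Fq F s Q b' := by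
  unfold sigmaComb
  rw [← Finset.sum_add_distrib]
  refine Finset.sum_congr rfl fun l _ => ?_
  rw [Pi.add_apply, Finsupp.sum_add_index' (by simp) (fun n c c' => add_smul c c' _)]

/-- `sigmaComb` as an additive map. -/
noncomputable def sigmaCombHom : (Idx s → ℕ →₀ F) →+ (Fin (k + 1) → F[X]) :=
  AddMonoidHom.mk' (sigmaComb Fq F s Q) (sigmaComb_add Fq F s Q)

theorem sigmaComb_single (l : Idx s) (n : ℕ) (c : F) :
    sigmaComb Fq F s Q (Pi.single l (Finsupp.single n c)) =
      c • (sigma Fq F s Q)^[n] (sigmaBasis Fq F s l) := by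
  unfold sigmaComb
  rw [Finset.sum_eq_single l]
  · simp
  · intro l' _ h
    simp [Pi.single_eq_of_ne h]
  · simp

/-- The coefficients of `b'` in `b = b(0) + σ b'`. -/
noncomputable def shiftDown (b : Idx s → ℕ →₀ F) (l : Idx s) : ℕ →₀ F :=
  Finsupp.mapRange (frobEquiv Fq F) (map_zero _) (Finsupp.comapDomain Nat.succ (b l)
    Nat.succ_injective.injOn)

theorem sigmaComb_eq (b : Idx s → ℕ →₀ F) :
    sigmaComb Fq F s Q b = (∑ l, b l 0 • sigmaBasis Fq F s l) +
      sigma Fq F s Q (sigmaComb Fq F s Q (shiftDown Fq F s b)) := by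
  conv_rhs => rw [show sigma Fq F s Q = sigmaHom Fq F s Q from rfl]
  simp only [sigmaComb, map_sum]
  rw [← Finset.sum_add_distrib]
  refine Finset.sum_congr rfl fun l _ => ?_
  rw [Finsupp.sum_of_support_subset (s := Finset.range ((b l).support.sup id + 2)) _ _ _ (by simp)]
  · rw [Finset.sum_range_succ']
    rw [Finsupp.sum_of_support_subset (s := Finset.range ((b l).support.sup id + 1)) _ _ _ (by simp)]
    · rw [map_sum]
      refine (add_comm _ _).trans ?_
      congr 1
      refine Finset.sum_congr rfl fun n _ => ?_
      rw [show (sigmaHom Fq F s Q : _ → _) = sigma Fq F s Q from rfl, sigma_pow_smul]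
      simp [shiftDown]
    · intro n hn
      simp only [shiftDown, Finsupp.mem_support_iff, Finsupp.mapRange_apply,
        Finsupp.comapDomain_apply, ne_eq, EmbeddingLike.map_eq_zero_iff] at hn
      have := Finset.le_sup (f := id) (Finsupp.mem_support_iff.2 hn)
      simp only [id, Finset.mem_range] at *
      omega
  · intro n hn
    have := Finset.le_sup (f := id) hn
    simp only [id, Finset.mem_range] at *
    omega

theorem jet_eq_zero (d : ℕ) (c : Fin d → F)
    (h : tSubTheta Fq F ^ d ∣ ∑ j, c j • tSubTheta Fq F ^ (d - 1 - j)) : c = 0 := by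
  have hx : (∑ j, c j • (X : F[X]) ^ (d - 1 - j)).comp (tSubTheta Fq F) = ∑ j, c j • tSubTheta Fq F ^ (d - 1 - j) := by
    rw [Polynomial.sum_comp]
    simp
  have h0 : ∑ j, c j • tSubTheta Fq F ^ (d - 1 - j) = 0 := by
    by_contra hne
    have hd : (∑ j, c j • tSubTheta Fq F ^ (d - 1 - j)).degree < d := by
      refine (Polynomial.degree_sum_le _ _).trans_lt ?_
      refine (Finset.sup_lt_iff (WithBot.bot_lt_coe d)).2 ?_
      intro j _
      refine (Polynomial.degree_smul_le _ _).trans_lt ?_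
      rw [Polynomial.degree_pow, Polynomial.degree_X_sub_C, nsmul_one]
      have := j.2
      exact WithBot.coe_lt_coe.2 (by omega : d - 1 - (j : ℕ) < d)
    refine hne (Polynomial.eq_zero_of_dvd_of_degree_lt h ?_)
    rwa [Polynomial.degree_pow, Polynomial.degree_X_sub_C, nsmul_one]
  have h1 : (∑ j, c j • (X : F[X]) ^ (d - 1 - j)) = 0 := by
    rw [← hx] at h0
    have := congrArg (fun p => p.comp (X + C (theta Fq F))) h0
    simpa [Polynomial.comp_assoc] using this
  funext j
  have h2 := congrArg (fun p => p.coeff (d - 1 - j)) h1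
  simp only [finsetSum_coeff, coeff_smul, coeff_X_pow, coeff_zero] at h2
  rw [Finset.sum_eq_single j] at h2
  · simpa using h2
  · intro i _ hij
    rw [if_neg, smul_zero]
    intro h
    apply hij
    ext
    omega
  · simp

theorem dvd_sigma (a : Fin (k + 1) → F[X]) (i : Fin (k + 1)) :
    tSubTheta Fq F ^ dSum s i ∣ sigma Fq F s Q a i := by
  rw [sigma_apply]; exact dvd_mul_right _ _

theorem sum_sigmaBasis_apply (c : Idx s → F) (i : Fin (k + 1)) :
    (∑ l, c l • sigmaBasis Fq F s l) i = ∑ j : Fin (dSum s i), c ⟨i, j⟩ • tSubTheta Fq F ^ (dSum s i - 1 - j) := by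
  rw [Finset.sum_apply, Fintype.sum_sigma, Finset.sum_eq_single i]
  · simp [sigmaBasis]
  · intro i' _ h
    simp [sigmaBasis, Pi.single_eq_of_ne h.symm]
  · simp

theorem jets_eq_zero (c : Idx s → F)
    (h : ∀ i, tSubTheta Fq F ^ dSum s i ∣ (∑ l, c l • sigmaBasis Fq F s l) i) : c = 0 := by
  funext ⟨i, j⟩
  have := h i
  rw [sum_sigmaBasis_apply] at this
  exact congrFun (jet_eq_zero Fq F _ _ this) j

theorem sigmaComb_injective : Function.Injective (sigmaComb Fq F s Q) := by
  rw [show sigmaComb Fq F s Q = sigmaCombHom Fq F s Q from rfl, injective_iff_map_eq_zero]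
  intro b hb
  have key : ∀ (n : ℕ) (b : Idx s → ℕ →₀ F), sigmaComb Fq F s Q b = 0 → ∀ l, b l n = 0 := by
    intro n
    have h0 : ∀ (b : Idx s → ℕ →₀ F), sigmaComb Fq F s Q b = 0 → ∀ l, b l 0 = 0 := by
      intro b hb
      rw [sigmaComb_eq] at hb
      refine fun l => congrFun (jets_eq_zero Fq F s (fun l => b l 0) fun i => ?_) l
      rw [eq_neg_of_add_eq_zero_left hb]
      exact (dvd_sigma Fq F s Q _ i).neg_right
    induction n with
    | zero => exact h0
    | succ n ih =>
      intro b hb l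
      have h1 := h0 b hb
      rw [sigmaComb_eq] at hb
      simp only [h1, zero_smul, Finset.sum_const_zero, zero_add] at hb
      have h2 : sigmaComb Fq F s Q (shiftDown Fq F s b) = 0 := by
        apply sigma_injective Fq F s Q
        rw [hb]
        exact (map_zero (sigmaHom Fq F s Q)).symm
      simpa [shiftDown] using ih _ h2 l
  funext l
  ext n
  exact key n b hb l

theorem mem_range_sigma {x : Fin (k + 1) → F[X]} (hx : x ∈ (sigmaCombHom Fq F s Q).range) :
    sigma Fq F s Q x ∈ (sigmaCombHom Fq F s Q).range := by
  obtain ⟨b, rfl⟩ := hx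
  rw [show sigma Fq F s Q = sigmaHom Fq F s Q from rfl]
  change sigmaHom Fq F s Q (sigmaComb Fq F s Q b) ∈ _
  unfold sigmaComb
  rw [map_sum]
  refine sum_mem fun l _ => ?_
  rw [Finsupp.sum, map_sum]
  refine sum_mem fun n _ => ?_
  refine ⟨Pi.single l (Finsupp.single (n + 1) ((frobEquiv Fq F).symm (b l n))), ?_⟩
  change sigmaComb Fq F s Q _ = sigma Fq F s Q _
  rw [sigmaComb_single, sigma_pow_smul]

theorem sigmaComb_surjective : Function.Surjective (sigmaComb Fq F s Q) := by
  set S := (sigmaCombHom Fq F s Q).range with hS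
  have hjet : ∀ (i : Fin (k + 1)) (p : F[X]), p.degree < dSum s i → Pi.single i p ∈ S := by
    intro i p hp
    have hp' : p = ∑ j : Fin (dSum s i), ((p.comp (X + C (theta Fq F))).coeff (dSum s i - 1 - j)) •
        tSubTheta Fq F ^ (dSum s i - 1 - j) := by
      have hdeg : (p.comp (X + C (theta Fq F))).degree < dSum s i := by
        rwa [← Polynomial.taylor_apply, Polynomial.degree_taylor]
      have hnat : (p.comp (X + C (theta Fq F))).natDegree < dSum s i := by
        by_cases h0 : p.comp (X + C (theta Fq F)) = 0
        · rw [h0, natDegree_zero]; exact dSum_pos s i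
        · exact (Polynomial.natDegree_lt_iff_degree_lt h0).2 hdeg
      have h1 := Polynomial.as_sum_range' (p.comp (X + C (theta Fq F))) (dSum s i)
        hnat
      have h2 := congrArg (fun f => f.comp (tSubTheta Fq F)) h1
      simp only [Polynomial.comp_assoc] at h2
      rw [show (X + C (theta Fq F) : F[X]).comp (tSubTheta Fq F) = X by simp, Polynomial.comp_X] at h2
      rw [Fin.sum_univ_eq_sum_range (fun j => ((p.comp (X + C (theta Fq F))).coeff (dSum s i - 1 - j)) •
        tSubTheta Fq F ^ (dSum s i - 1 - j)), Finset.sum_range_reflect (fun j =>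
          ((p.comp (X + C (theta Fq F))).coeff j) • tSubTheta Fq F ^ j)]
      conv_lhs => rw [h2]
      rw [Polynomial.sum_comp]
      simp [← Polynomial.C_mul_X_pow_eq_monomial, Polynomial.smul_eq_C_mul]
    have : (Pi.single i p : Fin (k + 1) → F[X]) = ∑ j : Fin (dSum s i),
        ((p.comp (X + C (theta Fq F))).coeff (dSum s i - 1 - j)) • sigmaBasis Fq F s ⟨i, j⟩ := by
      conv_lhs => rw [hp']
      simp only [sigmaBasis]
      funext i'
      by_cases h : i' = i
      · subst h; simp
      · simp [Pi.single_eq_of_ne h]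
    rw [this]
    refine sum_mem fun j _ => ⟨Pi.single ⟨i, j⟩ (Finsupp.single 0
      ((p.comp (X + C (theta Fq F))).coeff (dSum s i - 1 - j))), ?_⟩
    exact sigmaComb_single Fq F s Q _ 0 _
  have key : ∀ (m : ℕ) (hm : m < k + 1) (p : F[X]), Pi.single (⟨m, hm⟩ : Fin (k + 1)) p ∈ S := by
    intro m
    induction m using Nat.strong_induction_on with
    | _ m ihm =>
    intro hm
    have : ∀ (N : ℕ) (p : F[X]), p.natDegree ≤ N → Pi.single (⟨m, hm⟩ : Fin (k + 1)) p ∈ S := by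
      intro N
      induction N using Nat.strong_induction_on with
      | _ N ihN =>
      intro p hp
      set i : Fin (k + 1) := ⟨m, hm⟩ with hi
      by_cases hdeg : p.degree < dSum s i
      · exact hjet i p hdeg
      have hmonic : (tSubTheta Fq F ^ dSum s i).Monic := (monic_X_sub_C _).pow _
      set b := p /ₘ (tSubTheta Fq F ^ dSum s i) with hb
      have hsplit : p = p %ₘ (tSubTheta Fq F ^ dSum s i) + tSubTheta Fq F ^ dSum s i * b :=
        (Polynomial.modByMonic_add_div p _).symm
      have hnd : (tSubTheta Fq F ^ dSum s i).natDegree = dSum s i := by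
        rw [Polynomial.natDegree_pow, Polynomial.natDegree_X_sub_C, mul_one]
      have hmod : (p %ₘ (tSubTheta Fq F ^ dSum s i)).degree < dSum s i := by
        have := Polynomial.degree_modByMonic_lt p hmonic
        rwa [Polynomial.degree_pow, Polynomial.degree_X_sub_C, nsmul_one] at this
      have hpd : dSum s i ≤ p.natDegree := by
        have h1 : p ≠ 0 := by
          rintro rfl
          exact hdeg (by simp)
        rw [not_lt, Polynomial.degree_eq_natDegree h1] at hdeg
        exact_mod_cast hdeg
      have hbdeg : b.natDegree < N := by
        rw [hb, Polynomial.natDegree_divByMonic p hmonic, hnd]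
        have := dSum_pos s i
        omega
      have hb1 : Pi.single i (b.map (frobEquiv Fq F).toRingHom) ∈ S :=
        ihN b.natDegree hbdeg _ Polynomial.natDegree_map_le
      have hσ := mem_range_sigma Fq F s Q hb1
      rw [hsplit, Pi.single_add]
      refine add_mem (hjet i _ hmod) ?_
      have hdiff : Pi.single i (tSubTheta Fq F ^ dSum s i * b) -
          sigma Fq F s Q (Pi.single i (b.map (frobEquiv Fq F).toRingHom)) ∈ S := by
        have hz : rootTwist Fq F (0 : F[X]) = 0 := by simp [rootTwist]
        by_cases hm0 : m = 0
        · convert zero_mem S using 1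
          funext j
          rw [Pi.sub_apply, Pi.zero_apply, sigma_apply]
          have hn : nextEntry (fun i' => rootTwist Fq F
              ((Pi.single i (b.map (frobEquiv Fq F).toRingHom) : Fin (k + 1) → F[X]) i')) j = 0 := by
            unfold nextEntry
            split_ifs with hjk
            · beta_reduce
              rw [Pi.single_eq_of_ne, hz]
              intro h
              have := congrArg Fin.val h
              simp [hi, hm0] at this
            · rfl
          rw [hn]
          by_cases hj : j = i
          · subst hj; rw [Pi.single_eq_same, Pi.single_eq_same, rootTwist_map]; simp
          · simp [Pi.single_eq_of_ne hj, hz]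
        · have hlt : m - 1 < k + 1 := by omega
          convert ihm (m - 1) (by omega) hlt (-(tSubTheta Fq F ^ dSum s ⟨m - 1, hlt⟩ *
            (Qroot Fq F Q ⟨m - 1, hlt⟩ * b))) using 1
          funext j
          rw [Pi.sub_apply, sigma_apply]
          by_cases hj1 : j = ⟨m - 1, hlt⟩
          · have hji : j ≠ i := by
              rw [hj1]; intro h; have := congrArg Fin.val h; simp [hi] at this; omega
            have hn : nextEntry (fun i' => rootTwist Fq F
                ((Pi.single i (b.map (frobEquiv Fq F).toRingHom) : Fin (k + 1) → F[X]) i')) j = b := by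
              have hjk : (j : ℕ) < k := by rw [hj1]; simp; omega
              rw [nextEntry, dif_pos hjk]
              have : (⟨(j : ℕ) + 1, by omega⟩ : Fin (k + 1)) = i := by
                ext; have := congrArg Fin.val hj1; simp [hi] at this ⊢; omega
              rw [this, Pi.single_eq_same, rootTwist_map]
            rw [hn, Pi.single_eq_of_ne hji, Pi.single_eq_of_ne hji, hz, hj1, Pi.single_eq_same]
            ring
          · have hn : nextEntry (fun i' => rootTwist Fq F
                ((Pi.single i (b.map (frobEquiv Fq F).toRingHom) : Fin (k + 1) → F[X]) i')) j = 0 := by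
              unfold nextEntry
              split_ifs with hjk
              · beta_reduce
                rw [Pi.single_eq_of_ne, hz]
                intro h
                apply hj1
                have := congrArg Fin.val h
                ext
                simp [hi] at this ⊢
                omega
              · rfl
            rw [hn, Pi.single_eq_of_ne hj1]
            by_cases hj : j = i
            · subst hj; rw [Pi.single_eq_same, Pi.single_eq_same, rootTwist_map]; simp
            · simp [Pi.single_eq_of_ne hj, hz]
      have := add_mem hdiff hσ
      simpa using this
    exact fun p => this p.natDegree p le_rfl
  intro a
  have ha : a ∈ S := by
    rw [← Finset.univ_sum_single a]
    exact sum_mem fun i _ => key i i.2 _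
  exact ha

/-- `ι : Mat_{1 × r}(F[t]) → Mat_{1 × d}(F[σ])`, the coordinates with respect to the `F[σ]`-basis. -/
noncomputable def iota : (Fin (k + 1) → F[X]) ≃ (Idx s → ℕ →₀ F) :=
  (Equiv.ofBijective (sigmaComb Fq F s Q)
    ⟨sigmaComb_injective Fq F s Q, sigmaComb_surjective Fq F s Q⟩).symm


theorem sigmaComb_iota (a : Fin (k + 1) → F[X]) :
    sigmaComb Fq F s Q (iota Fq F s Q a) = a :=
  (Equiv.ofBijective (sigmaComb Fq F s Q)
    ⟨sigmaComb_injective Fq F s Q, sigmaComb_surjective Fq F s Q⟩).apply_symm_apply a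

/-- `δ₀(∑ cᵢ σ ^ i) = c₀`. -/
def delta0 (b : Idx s → ℕ →₀ F) : Idx s → F := fun l => b l 0

/-- `δ₁(∑ cᵢ σ ^ i) = ∑ cᵢ^{(i)}`. -/
noncomputable def delta1 (b : Idx s → ℕ →₀ F) : Idx s → F :=
  fun l => (b l).sum fun n c => c ^ (Fintype.card Fq ^ n)

theorem iota_eq_iff {a : Fin (k + 1) → F[X]} {b : Idx s → ℕ →₀ F} :
    iota Fq F s Q a = b ↔ a = sigmaComb Fq F s Q b := by
  constructor
  · rintro rfl; exact (sigmaComb_iota _ _ _ _ _).symm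
  · rintro rfl; exact sigmaComb_injective Fq F s Q (sigmaComb_iota _ _ _ _ _)

theorem delta0_iota (a : Fin (k + 1) → F[X]) (c : Idx s → F)
    (h : ∀ i, tSubTheta Fq F ^ dSum s i ∣ a i - (∑ l, c l • sigmaBasis Fq F s l) i) :
    delta0 F s (iota Fq F s Q a) = c := by
  have h1 := sigmaComb_iota Fq F s Q a
  rw [sigmaComb_eq] at h1
  rw [← sub_eq_zero]
  refine jets_eq_zero Fq F s _ fun i => ?_
  have h2 := dvd_sub (h i) (dvd_sigma Fq F s Q
    (sigmaComb Fq F s Q (shiftDown Fq F s (iota Fq F s Q a))) i)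
  have h3 : (∑ l, (delta0 F s (iota Fq F s Q a) - c) l • sigmaBasis Fq F s l) i = a i -
      (∑ l, c l • sigmaBasis Fq F s l) i - sigma Fq F s Q
        (sigmaComb Fq F s Q (shiftDown Fq F s (iota Fq F s Q a))) i := by
    have h4 := congrFun h1 i
    rw [Pi.add_apply] at h4
    simp only [Pi.sub_apply, sub_smul, Finset.sum_sub_distrib, delta0]
    linear_combination h4
  rw [h3]
  exact h2

/-- The coefficients of `ρ(t)`: if `t eₘ = ∑ₗ ∑ₙ cₗₙ σ ^ n eₗ`, then the column `m` of the coefficient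
of `τ ^ n` has the entries `cₗₙ ^ (q ^ n)`. `Delta_X_smul` shows that this is the operator which
multiplication by `t` on `M' / (σ - 1) M'` induces on `F ^ d` through `Δ = δ₁ ∘ ι`. -/
noncomputable def rhoTCoeff (n : ℕ) : Matrix (Idx s) (Idx s) F := Matrix.of fun l m =>
  (iota Fq F s Q ((X : F[X]) • sigmaBasis Fq F s m) l n) ^ (Fintype.card Fq ^ n)

theorem rhoTCoeff_finite : (Function.support (rhoTCoeff Fq F s Q)).Finite := by
  refine Set.Finite.subset (Finset.finite_toSet (Finset.univ.biUnion fun lm : Idx s × Idx s =>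
    (iota Fq F s Q ((X : F[X]) • sigmaBasis Fq F s lm.2) lm.1).support)) ?_
  intro n hn
  by_contra h
  apply hn
  ext l m
  have : iota Fq F s Q ((X : F[X]) • sigmaBasis Fq F s m) l n = 0 := by
    by_contra h'
    exact h (by simpa using ⟨l.1, l.2, m.1, m.2, h'⟩)
  simp [rhoTCoeff, this]

theorem rhoTCoeff_zero (l m : Idx s) :
    (rhoTCoeff Fq F s Q 0 - theta Fq F • (1 : Matrix (Idx s) (Idx s) F)) l m =
      if l.1 = m.1 ∧ (l.2 : ℕ) + 1 = m.2 then 1 else 0 := by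
  have key := delta0_iota Fq F s Q ((X : F[X]) • sigmaBasis Fq F s m)
    (fun l => (if l = m then theta Fq F else 0) +
      if l.1 = m.1 ∧ (l.2 : ℕ) + 1 = m.2 then 1 else 0) ?_
  · have := congrFun key l
    simp only [delta0] at this
    simp only [Matrix.sub_apply, rhoTCoeff, Matrix.of_apply, pow_zero, pow_one, this,
      Matrix.smul_apply, Matrix.one_apply, smul_eq_mul, mul_ite, mul_one, mul_zero]
    ring
  · intro i
    obtain ⟨m1, m2⟩ := m
    simp only [add_smul, Finset.sum_add_distrib, ite_smul, zero_smul, one_smul,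
      Finset.sum_ite_eq', Finset.mem_univ, if_true, Pi.add_apply, Pi.smul_apply]
    rw [← sub_sub]
    have h1 : (X : F[X]) • sigmaBasis Fq F s ⟨m1, m2⟩ i - theta Fq F • sigmaBasis Fq F s ⟨m1, m2⟩ i =
        tSubTheta Fq F * sigmaBasis Fq F s ⟨m1, m2⟩ i := by
      rw [smul_eq_mul, Polynomial.smul_eq_C_mul]; ring
    rw [h1]
    rcases Nat.eq_zero_or_pos (m2 : ℕ) with h0 | h0
    · have : (∑ x : Idx s, if x.1 = m1 ∧ (x.2 : ℕ) + 1 = m2 then sigmaBasis Fq F s x else 0) = 0 := by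
        refine Finset.sum_eq_zero fun x _ => if_neg ?_
        omega
      rw [this, Pi.zero_apply, sub_zero]
      by_cases hi : i = m1
      · subst hi
        simp only [sigmaBasis, Pi.single_eq_same, h0]
        rw [← pow_succ']
        have := dSum_pos s i
        exact pow_dvd_pow _ (by omega)
      · simp [sigmaBasis, Pi.single_eq_of_ne hi]
    · have : (∑ x : Idx s, if x.1 = m1 ∧ (x.2 : ℕ) + 1 = m2 then sigmaBasis Fq F s x else 0) =
          sigmaBasis Fq F s ⟨m1, ⟨m2 - 1, by omega⟩⟩ := by
        rw [Finset.sum_eq_single (⟨m1, ⟨m2 - 1, by omega⟩⟩ : Idx s)]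
        · rw [if_pos]; exact ⟨rfl, by simp; omega⟩
        · rintro ⟨x1, x2⟩ _ hx
          refine if_neg ?_
          rintro ⟨hx1, hx2⟩
          dsimp only at hx1 hx2
          subst hx1
          apply hx
          congr 1
          ext
          simp; omega
        · simp
      rw [this]
      convert dvd_zero _
      rw [sub_eq_zero]
      by_cases hi : i = m1
      · subst hi
        simp only [sigmaBasis, Pi.single_eq_same]
        rw [← pow_succ']
        congr 1
        have := m2.2
        omega
      · simp [sigmaBasis, Pi.single_eq_of_ne hi]

/-- The `t`-module `G` associated to the dual `t`-motive `M'`. -/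
noncomputable def tModule : TModule Fq F (Idx s) where
  rhoT := Finsupp.ofSupportFinite (rhoTCoeff Fq F s Q) (rhoTCoeff_finite Fq F s Q)
  nilpotent := by
    rw [show Finsupp.ofSupportFinite (rhoTCoeff Fq F s Q) (rhoTCoeff_finite Fq F s Q) 0 =
      rhoTCoeff Fq F s Q 0 from rfl]
    set N := rhoTCoeff Fq F s Q 0 - theta Fq F • (1 : Matrix (Idx s) (Idx s) F) with hN
    have key : ∀ (n : ℕ) (l m : Idx s), (m.2 : ℕ) < n → (N ^ n) l m = 0 := by
      intro n
      induction n with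
      | zero => intro l m h; omega
      | succ n ih =>
        intro l m h
        rw [pow_succ, Matrix.mul_apply]
        refine Finset.sum_eq_zero fun x _ => ?_
        by_cases hx : x.1 = m.1 ∧ (x.2 : ℕ) + 1 = m.2
        · rw [ih l x (by omega), zero_mul]
        · rw [hN, rhoTCoeff_zero, if_neg hx, mul_zero]
    refine ⟨∑ i, dSum s i, ?_⟩
    ext l m
    refine key _ l m (lt_of_lt_of_le m.2.2 ?_)
    exact Finset.single_le_sum (f := dSum s) (fun _ _ => Nat.zero_le _) (Finset.mem_univ m.1)

/-- `Δ = δ₁ ∘ ι : M' → F ^ d`, which induces `M' / (σ - 1) M' ≅ F ^ d`. -/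
noncomputable def Delta (a : Fin (k + 1) → F[X]) : Idx s → F := delta1 Fq F s (iota Fq F s Q a)

theorem delta1_add (b b' : Idx s → ℕ →₀ F) :
    delta1 Fq F s (b + b') = delta1 Fq F s b + delta1 Fq F s b' := by
  funext l
  simp only [delta1, Pi.add_apply]
  exact Finsupp.sum_add_index' (fun n => (frob Fq F n).map_zero) (fun n => (frob Fq F n).map_add)

theorem Delta_add (a a' : Fin (k + 1) → F[X]) :
    Delta Fq F s Q (a + a') = Delta Fq F s Q a + Delta Fq F s Q a' := by
  unfold Delta
  rw [← delta1_add]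
  congr 1
  rw [iota_eq_iff, sigmaComb_add, sigmaComb_iota, sigmaComb_iota]

/-- `Δ` as an additive map. -/
noncomputable def DeltaHom : (Fin (k + 1) → F[X]) →+ (Idx s → F) :=
  AddMonoidHom.mk' (Delta Fq F s Q) (Delta_add Fq F s Q)

theorem Delta_smul_pow (n : ℕ) (c : F) (l : Idx s) :
    Delta Fq F s Q (c • (sigma Fq F s Q)^[n] (sigmaBasis Fq F s l)) =
      Pi.single l (c ^ (Fintype.card Fq ^ n)) := by
  have h : iota Fq F s Q (c • (sigma Fq F s Q)^[n] (sigmaBasis Fq F s l)) =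
      Pi.single l (Finsupp.single n c) := by
    rw [iota_eq_iff, sigmaComb_single]
  unfold Delta
  rw [h]
  funext l'
  by_cases hl : l' = l
  · subst hl
    simp only [delta1, Pi.single_eq_same]
    exact Finsupp.sum_single_index (frob Fq F n).map_zero
  · simp [delta1, Pi.single_eq_of_ne hl]

theorem frobEquiv_apply (x : F) : frobEquiv Fq F x = x ^ Fintype.card Fq := by
  change x ^ (Fintype.card Fq ^ 1) = _
  rw [pow_one]

theorem Delta_sigma (a : Fin (k + 1) → F[X]) :
    Delta Fq F s Q (sigma Fq F s Q a) = Delta Fq F s Q a := by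
  rw [← sigmaComb_iota Fq F s Q a]
  change DeltaHom Fq F s Q (sigmaHom Fq F s Q _) = DeltaHom Fq F s Q _
  simp only [sigmaComb, Finsupp.sum, map_sum]
  refine Finset.sum_congr rfl fun l _ => Finset.sum_congr rfl fun n _ => ?_
  change Delta Fq F s Q (sigma Fq F s Q _) = Delta Fq F s Q _
  rw [sigma_pow_smul, Delta_smul_pow, Delta_smul_pow, pow_succ', pow_mul,
    ← frobEquiv_apply, RingEquiv.apply_symm_apply]

theorem sigma_X_smul (a : Fin (k + 1) → F[X]) :
    sigma Fq F s Q ((X : F[X]) • a) = (X : F[X]) • sigma Fq F s Q a := by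
  unfold sigma
  rw [← Matrix.smul_vecMul]
  congr 1
  ext1 i
  simp [rootTwist]

theorem Delta_smul_iterate (n : ℕ) (c : F) (a : Fin (k + 1) → F[X]) :
    Delta Fq F s Q (c • (sigma Fq F s Q)^[n] a) =
      Delta Fq F s Q ((c ^ (Fintype.card Fq ^ n)) • a) := by
  induction n generalizing c with
  | zero => simp
  | succ n ih =>
    rw [pow_succ', pow_mul, ← ih, ← frobEquiv_apply,
      ← Delta_sigma Fq F s Q (frobEquiv Fq F c • _), sigma_pow_smul, RingEquiv.symm_apply_apply]

theorem sigma_iterate_X_smul (n : ℕ) (a : Fin (k + 1) → F[X]) :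
    (sigma Fq F s Q)^[n] ((X : F[X]) • a) = (X : F[X]) • (sigma Fq F s Q)^[n] a := by
  induction n with
  | zero => rfl
  | succ n ih => rw [Function.iterate_succ_apply', Function.iterate_succ_apply', ih, sigma_X_smul]

theorem Delta_smul_apply (z : F) (a : Fin (k + 1) → F[X]) (l : Idx s) :
    Delta Fq F s Q (z • a) l = (iota Fq F s Q a l).sum fun n c =>
      c ^ (Fintype.card Fq ^ n) * z ^ (Fintype.card Fq ^ n) := by
  have h : iota Fq F s Q (z • a) = fun l => z • iota Fq F s Q a l := by
    rw [iota_eq_iff]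
    conv_lhs => rw [← sigmaComb_iota Fq F s Q a]
    unfold sigmaComb
    rw [Finset.smul_sum]
    refine Finset.sum_congr rfl fun l _ => ?_
    rw [Finsupp.sum_smul_index (by simp), Finsupp.smul_sum]
    simp [mul_smul]
  rw [Delta, h, delta1, Finsupp.sum_smul_index
    (fun n => zero_pow (pow_ne_zero _ Fintype.card_ne_zero))]
  refine Finset.sum_congr rfl fun n _ => ?_
  beta_reduce
  rw [mul_pow, mul_comm]

theorem Delta_surjective : Function.Surjective (Delta Fq F s Q) := by
  intro z
  refine ⟨∑ l, z l • sigmaBasis Fq F s l, ?_⟩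
  change DeltaHom Fq F s Q _ = z
  rw [map_sum]
  have h (l : Idx s) : DeltaHom Fq F s Q (z l • sigmaBasis Fq F s l) = Pi.single l (z l) := by
    have := Delta_smul_pow Fq F s Q 0 (z l) l
    rwa [pow_zero, pow_one] at this
  simp only [h]
  exact Finset.univ_sum_single z

theorem Delta_X_smul (a : Fin (k + 1) → F[X]) :
    Delta Fq F s Q ((X : F[X]) • a) = (tModule Fq F s Q).act (Delta Fq F s Q a) := by
  have hbase (z : F) (l : Idx s) : Delta Fq F s Q (z • (X : F[X]) • sigmaBasis Fq F s l) =
      (tModule Fq F s Q).act (Pi.single l z) := by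
    funext m
    rw [Delta_smul_apply, TModule.act, Finset.sum_apply]
    have hsub : (iota Fq F s Q ((X : F[X]) • sigmaBasis Fq F s l) m).support ⊆
        (tModule Fq F s Q).rhoT.support := by
      intro n hn
      rw [Finsupp.mem_support_iff] at hn ⊢
      intro h0
      have := congrFun (congrFun h0 m) l
      exact hn (eq_zero_of_pow_eq_zero (by exact this))
    rw [Finsupp.sum_of_support_subset _ hsub]
    · refine Finset.sum_congr rfl fun n _ => ?_
      rw [Matrix.mulVec, dotProduct, Finset.sum_eq_single l]
      · rw [Pi.single_eq_same]; rfl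
      · intro l' _ hl
        rw [Pi.single_eq_of_ne hl, zero_pow (pow_ne_zero _ Fintype.card_ne_zero), mul_zero]
      · simp
    · intro n _
      rw [zero_pow (pow_ne_zero _ Fintype.card_ne_zero), zero_mul]
  let A : (Idx s → F) →+ (Idx s → F) := AddMonoidHom.mk' (tModule Fq F s Q).act fun x y => by
    simp only [TModule.act, Pi.add_apply, add_pow_card_pow Fq F]
    rw [← Finset.sum_add_distrib]
    exact Finset.sum_congr rfl fun n _ => Matrix.mulVec_add _ _ _
  change DeltaHom Fq F s Q _ = A (DeltaHom Fq F s Q _)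
  conv_lhs => rw [← sigmaComb_iota Fq F s Q a]
  conv_rhs => rw [← sigmaComb_iota Fq F s Q a]
  simp only [sigmaComb, Finsupp.sum, map_sum, Finset.smul_sum]
  refine Finset.sum_congr rfl fun l _ => Finset.sum_congr rfl fun n _ => ?_
  change Delta Fq F s Q _ = (tModule Fq F s Q).act (Delta Fq F s Q _)
  rw [Delta_smul_pow, ← hbase, smul_comm, ← sigma_iterate_X_smul, Delta_smul_iterate]

end DualMotive

/-! ### The series for the logarithm -/

section LogSeries

variable (C : Type*) [NormedField C] [Algebra (RatFunc Fq) C] [Algebra F C]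

/-- The inclusion `F[t] ⊆ C((t))`, for `F ⊆ C`. -/
noncomputable def toLaurent : F[X] →+* LaurentSeries C :=
  ((HahnSeries.ofPowerSeries ℤ C).comp Polynomial.coeToPowerSeries.ringHom).comp
    (Polynomial.mapRingHom (algebraMap F C))

/-- The twist `f^{(n)}` of a Laurent series, for `n ≥ 0`. -/
def laurentTwist (n : ℕ) (f : LaurentSeries C) : LaurentSeries C := f.map (frob Fq C n)

/-- The Laurent series `f` lies in the Tate algebra `𝕋_θ ⊆ C[[t]]`. -/
def InTate (f : LaurentSeries C) : Prop :=
  (∀ m < 0, f.coeff m = 0) ∧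
    Filter.Tendsto (fun m : ℕ => ‖f.coeff m * theta Fq C ^ m‖) Filter.atTop (nhds 0)

/-- The value `f|_{t = θ}` of `f ∈ 𝕋_θ`. -/
noncomputable def evalTheta (f : LaurentSeries C) : C := ∑' m : ℕ, f.coeff m * theta Fq C ^ m

variable [IsAlgClosed F] {k : ℕ} (s : Fin (k + 1) → ℕ+) (Q : Fin k → F[X])

/-- `Θ = (Φ'⁻¹)^tr`. -/
noncomputable def Theta : Matrix (Fin (k + 1)) (Fin (k + 1)) (LaurentSeries C) :=
  ((PhiPrime Fq F s Q).map (toLaurent F C))⁻¹.transpose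

/-- The block diagonal `r × d` matrix `X` with the rows `𝐱ᵢ = ((t - θ) ^ (dᵢ - 1), …, t - θ, 1)`. -/
noncomputable def XMat : Matrix (Fin (k + 1)) (Idx s) (LaurentSeries C) := Matrix.of fun i l =>
  if i = l.1 then toLaurent F C ((X - Polynomial.C (theta Fq F)) ^ (dSum s l.1 - 1 - l.2)) else 0

/-- The operator `D`, which replaces the row `i` by its hyperderivatives of the orders
`dᵢ - 1, …, 1, 0`. -/
noncomputable def DOp (B : Matrix (Fin (k + 1)) (Idx s) (LaurentSeries C)) :
    Matrix (Idx s) (Idx s) (LaurentSeries C) := Matrix.of fun l m =>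
  LaurentSeries.hasseDeriv C (dSum s l.1 - 1 - l.2) (B l.1 m)

/-- `D((Θ^{(1)} ⋯ Θ^{(n)}) X^{(n)})`. -/
noncomputable def logMatrix (n : ℕ) : Matrix (Idx s) (Idx s) (LaurentSeries C) :=
  DOp C s (((List.range n).map fun m => (Theta Fq F C s Q).map (laurentTwist Fq C (m + 1))).prod *
    (XMat Fq F C s).map (laurentTwist Fq C n))

/-- `D((Θ^{(1)} ⋯ Θ^{(n)}) X^{(n)})|_{t = θ} c^{(n)}`. -/
noncomputable def logTerm (c : Idx s → C) (n : ℕ) : Idx s → C :=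
  ((logMatrix Fq F C s Q n).map (evalTheta Fq C)).mulVec fun l => c l ^ (Fintype.card Fq ^ n)

end LogSeries
end TModules

end TMot

open Polynomial TMot

/-!
The matrices `Pₙ = D((Θ^{(1)} ⋯ Θ^{(n)}) X^{(n)})|_{t = θ}` are the coefficients of a logarithm
`P = ∑ Pₙ τ ^ n` of `G`. Since `Θ^{(n+1)}` is inverse to the transpose of `Φ'^{(n+1)}`, replacing
`a ∈ M'` by `σ a` turns the hyperderivatives at `t = θ` of `Θ^{(1)} ⋯ Θ^{(n+1)} (a^{(n+1)})^tr` into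
those of `Θ^{(1)} ⋯ Θ^{(n)} (a^{(n)})^tr`, while by Leibniz' rule multiplication of `a` by `t` acts
on them as `∂ρ(t)`. Expanding `t eₗ` in the `𝕂[σ]`-basis therefore gives `∂ρ(t) P = P ρ(t)`. As
`P₀ = 1`, the skew series `Exp_G P` has constant term `1`, and it commutes with `∂ρ(t)`; since
`∂ρ(t) - θ` is nilpotent, this forces `Exp_G P = 1`.

For convergence, the entries of `Θ^{(1)} ⋯ Θ^{(n)}` are bounded in the Gauss norm of the disc
`|t| ≤ |θ|^q`. Conjugation by weights built from powers of `|π̃| = |θ|^{q/(q-1)}` makes the bounds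
of the factors telescope, and the hypothesis on `c` is what makes `Pₙ c^{(n)}` tend to `0`. The
coefficients of `Exp_G` decay superexponentially, so that the double series for `Exp_G(Y)` may be
summed along its diagonals.
-/

namespace TMot

open Filter Topology Matrix
open Finset.HasAntidiagonal (antidiagonal mem_antidiagonal)

/-! ### Skew power series -/

section SkewPowerSeries

/-- The product of the skew power series `∑ᵢ aᵢ τ ^ i` and `∑ⱼ bⱼ τ ^ j` over `R`, where
`τ x = φ x τ`. A skew power series is represented by the sequence of its coefficients. -/
def skewMul {R : Type*} [Semiring R] (φ : R →+* R) (a b : ℕ → R) (m : ℕ) : R :=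
  ∑ p ∈ antidiagonal m, a p.1 * (φ ^ p.1) (b p.2)

theorem skewMul_assoc {R : Type*} [Semiring R] (φ : R →+* R) (a b c : ℕ → R) :
    skewMul φ (skewMul φ a b) c = skewMul φ a (skewMul φ b c) := by
  funext m
  simp only [skewMul, map_sum, map_mul, Finset.sum_mul, Finset.mul_sum, Finset.sum_sigma']
  refine Finset.sum_nbij' (fun ⟨⟨_, j⟩, ⟨k, l⟩⟩ => ⟨(k, l + j), (l, j)⟩)
    (fun ⟨⟨i, _⟩, ⟨k, l⟩⟩ => ⟨(i + k, l), (i, k)⟩) ?_ ?_ ?_ ?_ ?_ <;>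
    rintro ⟨⟨i, j⟩, ⟨k, l⟩⟩ h <;>
    simp only [Finset.mem_sigma, mem_antidiagonal] at h ⊢ <;>
    obtain ⟨rfl, rfl⟩ := h
  · simp [add_assoc]
  · simp [add_assoc]
  · rfl
  · rfl
  · rw [mul_assoc, pow_add, RingHom.mul_def, RingHom.comp_apply]

theorem skewMul_single_zero {R : Type*} [Semiring R] (φ : R →+* R) (a : ℕ → R) (x : R) (m : ℕ) :
    skewMul φ a (Pi.single 0 x) m = a m * (φ ^ m) x := by
  rw [skewMul, Finset.sum_eq_single (m, 0)]
  · simp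
  · rintro ⟨i, j⟩ h hne
    have hj : j ≠ 0 := by
      rintro rfl
      exact hne (by simpa using h)
    simp [hj]
  · simp

theorem single_zero_skewMul {R : Type*} [Semiring R] (φ : R →+* R) (x : R) (b : ℕ → R) (m : ℕ) :
    skewMul φ (Pi.single 0 x) b m = x * b m := by
  rw [skewMul, Finset.sum_eq_single (0, m)]
  · simp
  · rintro ⟨i, j⟩ h hne
    have hi : i ≠ 0 := by
      rintro rfl
      exact hne (by simpa using h)
    simp [hi]
  · simp

theorem eq_single_zero_one_of_skewMul_comm {R : Type*} [Ring R] {φ : R →+* R} {a T : ℕ → R}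
    (hT0 : T 0 = 1) (hTa : skewMul φ T a = skewMul φ a T)
    (ha : ∀ m ≠ 0, ∀ x, x * (φ ^ m) (a 0) = a 0 * x → x = 0) : T = Pi.single 0 1 := by
  funext m
  induction m using Nat.strong_induction_on with
  | _ m ih =>
  rcases eq_or_ne m 0 with rfl | hm
  · simp [hT0]
  have hne : ((0, m) : ℕ × ℕ) ≠ (m, 0) := fun h => hm (Prod.ext_iff.1 h).2
  have hT (i : ℕ) (h0 : i ≠ 0) (hi : i < m) : T i = 0 := by rw [ih i hi, Pi.single_eq_of_ne h0]
  have h := congrFun hTa m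
  rw [skewMul, skewMul,
    Finset.sum_eq_add_of_mem (0, m) (m, 0) (by simp) (by simp) hne,
    Finset.sum_eq_add_of_mem (0, m) (m, 0) (by simp) (by simp) hne] at h
  · rw [Pi.single_eq_of_ne hm]
    exact ha m hm _ (by simpa [hT0, add_comm] using h)
  · rintro ⟨i, j⟩ hij ⟨h1, h2⟩
    rw [mem_antidiagonal] at hij
    rw [hT j (by grind) (by grind), map_zero, mul_zero]
  · rintro ⟨i, j⟩ hij ⟨h1, h2⟩
    rw [mem_antidiagonal] at hij
    rw [hT i (by grind) (by grind), zero_mul]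

end SkewPowerSeries

section TwistedMulVec

variable {Fq : Type*} [Field Fq] [Fintype Fq] {C : Type*} [Field C] [Algebra (RatFunc Fq) C]
  {n : Type*} [Fintype n]

variable (Fq) in
/-- The additive map `z ↦ M z^{(i)}`, that is, the action of the monomial `M τ ^ i` on vectors. -/
def twistedMulVec (M : Matrix n n C) (i : ℕ) : (n → C) →+ (n → C) where
  toFun z := M *ᵥ fun l => z l ^ (Fintype.card Fq ^ i)
  map_zero' := by
    simp only [Pi.zero_apply, zero_pow (pow_ne_zero i Fintype.card_ne_zero)]
    exact mulVec_zero M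
  map_add' x y := by
    simp only [Pi.add_apply, add_pow_card_pow]
    exact mulVec_add M _ _

theorem twistedMulVec_apply (M : Matrix n n C) (i : ℕ) (z : n → C) :
    twistedMulVec Fq M i z = M *ᵥ fun l => z l ^ (Fintype.card Fq ^ i) := rfl

theorem sum_twistedMulVec {ι : Type*} (S : Finset ι) (M : ι → Matrix n n C) (i : ℕ) (z : n → C) :
    twistedMulVec Fq (∑ j ∈ S, M j) i z = ∑ j ∈ S, twistedMulVec Fq (M j) i z :=
  sum_mulVec _ _ _

theorem twistedMulVec_zero (i : ℕ) (z : n → C) : twistedMulVec Fq (0 : Matrix n n C) i z = 0 :=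
  zero_mulVec _

variable [DecidableEq n]

theorem twistedMulVec_one_zero (z : n → C) : twistedMulVec Fq (1 : Matrix n n C) 0 z = z := by
  simp [twistedMulVec_apply]

variable (Fq C n) in
/-- The entrywise `q`-power Frobenius on matrices. -/
def matrixFrob : Matrix n n C →+* Matrix n n C := (frob Fq C 1).mapMatrix

theorem matrixFrob_pow_apply (i : ℕ) (M : Matrix n n C) :
    (matrixFrob Fq C n ^ i) M = M.map (frob Fq C i) := by
  induction i with
  | zero => ext; simp
  | succ i ih =>
    rw [pow_succ', RingHom.mul_def, RingHom.comp_apply, ih]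
    ext
    simp [matrixFrob, pow_succ, pow_mul]

theorem twistedMulVec_twistedMulVec (M M' : Matrix n n C) (i j : ℕ) (z : n → C) :
    twistedMulVec Fq M i (twistedMulVec Fq M' j z) =
      twistedMulVec Fq (M * (matrixFrob Fq C n ^ i) M') (i + j) z := by
  have h : (fun l => (M' *ᵥ fun l => z l ^ (Fintype.card Fq ^ j)) l ^ (Fintype.card Fq ^ i)) =
      M'.map (frob Fq C i) *ᵥ fun l => z l ^ (Fintype.card Fq ^ (i + j)) := by
    funext l
    rw [← frob_apply Fq C, RingHom.map_mulVec]
    simp only [Function.comp_def, frob_apply, ← pow_mul, ← pow_add, add_comm j i]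
  rw [matrixFrob_pow_apply, twistedMulVec_apply, twistedMulVec_apply, twistedMulVec_apply, h,
    mulVec_mulVec]

theorem twistedMulVec_skewMul (a b : ℕ → Matrix n n C) (m : ℕ) (z : n → C) :
    twistedMulVec Fq (skewMul (matrixFrob Fq C n) a b m) m z =
      ∑ p ∈ antidiagonal m, twistedMulVec Fq (a p.1) p.1 (twistedMulVec Fq (b p.2) p.2 z) := by
  rw [skewMul, sum_twistedMulVec]
  refine Finset.sum_congr rfl fun p hp => ?_
  rw [twistedMulVec_twistedMulVec, mem_antidiagonal.1 hp]

end TwistedMulVec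

section MatrixNorm

open scoped Matrix.Norms.Elementwise

variable {C : Type*} [NormedField C] [IsUltrametricDist C]
  {l m n : Type*} [Fintype l] [Fintype m] [Fintype n]

scoped instance isUltrametricDist_matrix : IsUltrametricDist (Matrix m n C) :=
  inferInstanceAs (IsUltrametricDist (m → n → C))

theorem norm_matrix_mul_le (A : Matrix l m C) (B : Matrix m n C) : ‖A * B‖ ≤ ‖A‖ * ‖B‖ := by
  refine (Matrix.norm_le_iff (by positivity)).2 fun i j => ?_
  refine IsUltrametricDist.norm_sum_le_of_forall_le_of_nonneg (by positivity) fun k _ => ?_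
  exact (norm_mul_le _ _).trans (by gcongr <;> exact norm_entry_le_entrywise_sup_norm _)

theorem norm_mulVec_le (A : Matrix l m C) (z : m → C) : ‖A *ᵥ z‖ ≤ ‖A‖ * ‖z‖ := by
  refine (pi_norm_le_iff_of_nonneg (by positivity)).2 fun i => ?_
  refine IsUltrametricDist.norm_sum_le_of_forall_le_of_nonneg (by positivity) fun k _ => ?_
  exact (norm_mul_le _ _).trans (by
    gcongr; exacts [norm_entry_le_entrywise_sup_norm _, norm_le_pi_norm _ _])

variable {Fq : Type*} [Field Fq] [Fintype Fq] [Algebra (RatFunc Fq) C]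

omit [IsUltrametricDist C] in
theorem norm_map_frob_le (i : ℕ) (M : Matrix m n C) :
    ‖M.map (frob Fq C i)‖ ≤ ‖M‖ ^ (Fintype.card Fq ^ i) := by
  refine (Matrix.norm_le_iff (by positivity)).2 fun a b => ?_
  rw [map_apply, frob_apply, norm_pow]
  gcongr
  exact norm_entry_le_entrywise_sup_norm M

theorem norm_twistedMulVec_le (M : Matrix n n C) (i : ℕ) (z : n → C) :
    ‖twistedMulVec Fq M i z‖ ≤ ‖M‖ * ‖z‖ ^ (Fintype.card Fq ^ i) := by
  refine (norm_mulVec_le _ _).trans ?_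
  gcongr
  refine (pi_norm_le_iff_of_nonneg (by positivity)).2 fun l => ?_
  rw [norm_pow]
  gcongr
  exact norm_le_pi_norm z l

omit [IsUltrametricDist C] in
theorem continuous_twistedMulVec (M : Matrix n n C) (i : ℕ) :
    Continuous (twistedMulVec Fq M i) :=
  continuous_const.matrix_mulVec (continuous_pi fun l => (continuous_apply l).pow _)

end MatrixNorm

section DoubleSeries

theorem tendsto_cofinite_of_norm_le {ι κ E : Type*} [SeminormedAddCommGroup E] {u : ι × κ → E}
    {α : ι → ℝ} (hα : Tendsto α cofinite (𝓝 0)) (hu : ∀ i j, ‖u (i, j)‖ ≤ α i)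
    (hu' : ∀ i, Tendsto (fun j => u (i, j)) cofinite (𝓝 0)) : Tendsto u cofinite (𝓝 0) := by
  refine Metric.tendsto_nhds.2 fun ε hε => ?_
  have hI := eventually_cofinite.1 (hα.eventually_lt_const hε)
  have hJ (i : ι) := eventually_cofinite.1 (Metric.tendsto_nhds.1 (hu' i) ε hε)
  refine eventually_cofinite.2 ((hI.biUnion fun i _ => (hJ i).image (Prod.mk i)).subset ?_)
  rintro ⟨i, j⟩ hij
  refine Set.mem_biUnion (x := i) (fun hi => hij ?_) ⟨j, hij, rfl⟩
  rw [dist_zero_right]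
  exact (hu i j).trans_lt hi

open scoped Matrix.Norms.Elementwise

variable {Fq : Type*} [Field Fq] [Fintype Fq] {C : Type*} [NormedField C] [IsUltrametricDist C]
  [CompleteSpace C] [Algebra (RatFunc Fq) C] {n : Type*} [Fintype n]
  {E P : ℕ → Matrix n n C} {c : n → C}

theorem summable_twistedMulVec_twistedMulVec
    (hE : ∀ B : ℝ, Tendsto (fun i => ‖E i‖ * B ^ (Fintype.card Fq ^ i)) atTop (𝓝 0))
    (hP : Tendsto (fun j => twistedMulVec Fq (P j) j c) atTop (𝓝 0)) :
    Summable fun p : ℕ × ℕ =>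
      twistedMulVec Fq (E p.1) p.1 (twistedMulVec Fq (P p.2) p.2 c) := by
  obtain ⟨B, hB⟩ := hP.norm.bddAbove_range
  refine NonarchimedeanAddGroup.summable_of_tendsto_cofinite_zero
    (tendsto_cofinite_of_norm_le (α := fun i => ‖E i‖ * B ^ (Fintype.card Fq ^ i)) ?_
      (fun i j => ?_) fun i => ?_)
  · simpa only [Nat.cofinite_eq_atTop] using hE B
  · refine (norm_twistedMulVec_le _ _ _).trans ?_
    gcongr
    exact hB ⟨j, rfl⟩
  · have h := ((continuous_twistedMulVec (Fq := Fq) (E i) i).tendsto 0).comp hP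
    rwa [map_zero, ← Nat.cofinite_eq_atTop] at h

variable [DecidableEq n]

theorem hasSum_twistedMulVec_tsum
    (hE : ∀ B : ℝ, Tendsto (fun i => ‖E i‖ * B ^ (Fintype.card Fq ^ i)) atTop (𝓝 0))
    (hP : Tendsto (fun j => twistedMulVec Fq (P j) j c) atTop (𝓝 0)) :
    HasSum (fun i => twistedMulVec Fq (E i) i (∑' j, twistedMulVec Fq (P j) j c))
      (∑' m, twistedMulVec Fq (skewMul (matrixFrob Fq C n) E P m) m c) := by
  have hY : Summable fun j => twistedMulVec Fq (P j) j c :=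
    NonarchimedeanAddGroup.summable_of_tendsto_cofinite_zero (by rwa [Nat.cofinite_eq_atTop])
  have hS := (summable_twistedMulVec_twistedMulVec hE hP).hasSum
  have hdiag (m : ℕ) : HasSum (fun p : antidiagonal m =>
      twistedMulVec Fq (E p.1.1) p.1.1 (twistedMulVec Fq (P p.1.2) p.1.2 c))
      (twistedMulVec Fq (skewMul (matrixFrob Fq C n) E P m) m c) := by
    rw [twistedMulVec_skewMul, ← Finset.sum_coe_sort]
    exact hasSum_fintype _
  rw [((Finset.HasAntidiagonal.sigmaAntidiagonalEquivProd.hasSum_iff.2 hS).sigma hdiag).tsum_eq]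
  exact hS.prod_fiberwise fun i => hY.hasSum.map _ (continuous_twistedMulVec (E i) i)

theorem hasSum_twistedMulVec_of_skewMul_eq_one
    (hE : ∀ B : ℝ, Tendsto (fun i => ‖E i‖ * B ^ (Fintype.card Fq ^ i)) atTop (𝓝 0))
    (hP : Tendsto (fun j => twistedMulVec Fq (P j) j c) atTop (𝓝 0))
    (hEP : skewMul (matrixFrob Fq C n) E P = Pi.single 0 1) :
    HasSum (fun i => twistedMulVec Fq (E i) i (∑' j, twistedMulVec Fq (P j) j c)) c := by
  convert hasSum_twistedMulVec_tsum hE hP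
  rw [hEP, tsum_eq_single 0 fun m hm => by rw [Pi.single_eq_of_ne hm, twistedMulVec_zero],
    Pi.single_eq_same, twistedMulVec_one_zero]

end DoubleSeries

/-! ### The exponential of a `t`-module -/

section EntireExponential

theorem mul_le_pow_of_recursion {q N : ℕ} (hq : 2 ≤ q) {r ρ D : ℝ} {e : ℕ → ℝ}
    (he : ∀ m, 0 ≤ e m) (hr0 : 0 < r) (hr1 : r ≤ 1) (hρr : 1 ≤ ρ * r ^ N) (hD : 1 ≤ D)
    (h : ∀ m ≠ 0, ∃ i, i ≠ 0 ∧ i ≤ N ∧ i ≤ m ∧ ρ ^ q ^ m * e m ≤ D * e (m - i) ^ q ^ i) (m : ℕ) :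
    D * e m ≤ (D * e 0 * r ^ m) ^ q ^ m := by
  induction m using Nat.strong_induction_on with
  | _ m ih =>
  rcases eq_or_ne m 0 with rfl | hm
  · simp
  obtain ⟨i, hi0, hiN, him, hi⟩ := h m hm
  have hD0 : 0 ≤ D := zero_le_one.trans hD
  have he0 := he 0
  have hr : r ^ (m - i) * r ^ N ≤ r ^ m := by
    rw [← pow_add]
    exact pow_le_pow_of_le_one hr0.le hr1 (by omega)
  calc D * e m ≤ (ρ * r ^ N) ^ q ^ m * (D * e m) :=
        le_mul_of_one_le_left (mul_nonneg hD0 (he m)) (one_le_pow₀ hρr)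
    _ = D * (ρ ^ q ^ m * e m) * (r ^ N) ^ q ^ m := by ring
    _ ≤ D * (D * e (m - i) ^ q ^ i) * (r ^ N) ^ q ^ m := by gcongr
    _ = D ^ 2 * e (m - i) ^ q ^ i * (r ^ N) ^ q ^ m := by ring
    _ ≤ D ^ q ^ i * e (m - i) ^ q ^ i * (r ^ N) ^ q ^ m := by
        have := he (m - i)
        gcongr
        exact hq.trans (Nat.le_self_pow hi0 q)
    _ = (D * e (m - i)) ^ q ^ i * (r ^ N) ^ q ^ m := by rw [mul_pow]
    _ ≤ ((D * e 0 * r ^ (m - i)) ^ q ^ (m - i)) ^ q ^ i * (r ^ N) ^ q ^ m := by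
        have := mul_nonneg hD0 (he (m - i))
        gcongr
        exact ih (m - i) (by omega)
    _ = (D * e 0 * (r ^ (m - i) * r ^ N)) ^ q ^ m := by
        rw [← pow_mul, ← pow_add, Nat.sub_add_cancel him, ← mul_pow, mul_assoc]
    _ ≤ (D * e 0 * r ^ m) ^ q ^ m := by gcongr

theorem tendsto_mul_pow_of_recursion {q N : ℕ} (hq : 2 ≤ q) {ρ D : ℝ} {e : ℕ → ℝ}
    (he : ∀ m, 0 ≤ e m) (hρ : 1 < ρ) (hD : 1 ≤ D)
    (h : ∀ m ≠ 0, ∃ i, i ≠ 0 ∧ i ≤ N ∧ i ≤ m ∧ ρ ^ q ^ m * e m ≤ D * e (m - i) ^ q ^ i)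
    (B : ℝ) : Tendsto (fun m => e m * B ^ q ^ m) atTop (𝓝 0) := by
  obtain ⟨r, hr0, hr1, hρr⟩ : ∃ r : ℝ, 0 < r ∧ r < 1 ∧ 1 ≤ ρ * r ^ N := by
    have hcont : Tendsto (fun r : ℝ => ρ * r ^ N) (𝓝[<] 1) (𝓝 ρ) := by
      have : Continuous fun r : ℝ => ρ * r ^ N := by fun_prop
      simpa using (this.tendsto 1).mono_left nhdsWithin_le_nhds
    obtain ⟨r, hr, h⟩ := ((hcont.eventually_const_lt hρ).and
      (Ioo_mem_nhdsLT zero_lt_one)).exists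
    exact ⟨r, h.1, h.2, hr.le⟩
  have hle (m : ℕ) : ‖e m * B ^ q ^ m‖ ≤ (D * e 0 * |B| * r ^ m) ^ q ^ m := by
    rw [norm_mul, norm_pow, Real.norm_of_nonneg (he m), Real.norm_eq_abs]
    calc e m * |B| ^ q ^ m ≤ D * e m * |B| ^ q ^ m := by
          gcongr
          exact le_mul_of_one_le_left (he m) hD
      _ ≤ (D * e 0 * r ^ m) ^ q ^ m * |B| ^ q ^ m := by
          gcongr
          exact mul_le_pow_of_recursion hq he hr0 hr1.le hρr hD h m
      _ = _ := by ring
  have hlim : Tendsto (fun m => D * e 0 * |B| * r ^ m) atTop (𝓝 0) := by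
    simpa using (tendsto_pow_atTop_nhds_zero_of_lt_one hr0.le hr1).const_mul (D * e 0 * |B|)
  have he0 := he 0
  refine squeeze_zero_norm' ?_ hlim
  filter_upwards [hlim.eventually_le_const zero_lt_one] with m hm
  exact (hle m).trans (pow_le_of_le_one (by positivity) hm (pow_ne_zero m (by omega)))

open scoped Matrix.Norms.Elementwise

variable {Fq : Type*} [Field Fq] [Fintype Fq] {C : Type*} [NormedField C] [IsUltrametricDist C]
  [Algebra (RatFunc Fq) C] {n : Type*} [Fintype n] [DecidableEq n]

theorem pow_mul_norm_le_norm_sylvester (hθ : 1 < ‖theta Fq C‖) {A : Matrix n n C}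
    (hA : ‖A - theta Fq C • 1‖ < ‖theta Fq C‖) {m : ℕ} (hm : m ≠ 0) (M : Matrix n n C) :
    ‖theta Fq C‖ ^ Fintype.card Fq ^ m * ‖M‖ ≤ ‖M * A.map (frob Fq C m) - A * M‖ := by
  rcases eq_or_ne M 0 with rfl | hM
  · simp
  set θ := theta Fq C
  set N := A - θ • 1 with hN
  have hqm : 1 < Fintype.card Fq ^ m := Nat.one_lt_pow hm Fintype.one_lt_card
  have hAm : A.map (frob Fq C m) = θ ^ Fintype.card Fq ^ m • 1 + N.map (frob Fq C m) := by
    ext a b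
    rcases eq_or_ne a b with rfl | hab
    · simp [hN, ← add_pow_card_pow]
    · simp [hN, hab]
  have hdecomp : θ ^ Fintype.card Fq ^ m • M =
      (M * A.map (frob Fq C m) - A * M) + (θ • M + (N * M + -(M * N.map (frob Fq C m)))) := by
    rw [hAm, show A = θ • 1 + N by rw [hN]; abel]
    simp only [mul_add, add_mul, mul_smul_one, smul_mul_assoc, one_mul]
    abel
  have hθm : ‖θ‖ < ‖θ‖ ^ Fintype.card Fq ^ m := lt_self_pow₀ hθ hqm
  have hlt : ‖θ • M + (N * M + -(M * N.map (frob Fq C m)))‖ < ‖θ ^ Fintype.card Fq ^ m • M‖ := by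
    have hNM : ‖N * M‖ ≤ ‖N‖ * ‖M‖ := norm_matrix_mul_le N M
    have hMN : ‖M * N.map (frob Fq C m)‖ ≤ ‖N‖ ^ Fintype.card Fq ^ m * ‖M‖ := by
      rw [mul_comm (_ ^ _)]
      exact (norm_matrix_mul_le _ _).trans (by gcongr; exact norm_map_frob_le m N)
    have : 0 < ‖M‖ := norm_pos_iff.2 hM
    rw [norm_smul, norm_pow]
    refine (IsUltrametricDist.norm_add_le_max _ _).trans_lt (max_lt ?_ ?_)
    · rw [norm_smul]
      gcongr
    refine (IsUltrametricDist.norm_add_le_max _ _).trans_lt (max_lt ?_ ?_)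
    · exact hNM.trans_lt (by gcongr; exact hA.trans hθm)
    · rw [norm_neg]
      exact hMN.trans_lt (by gcongr)
  have hmax := (congrArg norm hdecomp).le.trans (IsUltrametricDist.norm_add_le_max _ _)
  rw [le_max_iff, or_iff_left hlt.not_ge, norm_smul, norm_pow] at hmax
  exact hmax

end EntireExponential

namespace TModule

open scoped Matrix.Norms.Elementwise

section Exponential

variable {Fq : Type*} [Field Fq] [Fintype Fq] {C : Type*} [NormedField C] [IsUltrametricDist C]
  [Algebra (RatFunc Fq) C] {n : Type*} [Fintype n] [DecidableEq n] {G : TModule Fq C n}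

omit [IsUltrametricDist C] in
theorem IsExpCoeff.mul_map_frob_sub {e : ℕ → Matrix n n C}
    (he : G.IsExpCoeff e) (m : ℕ) :
    e m * (G.rhoT 0).map (frob Fq C m) - G.rhoT 0 * e m =
      ∑ i ∈ Finset.range m, G.rhoT (i + 1) * (e (m - (i + 1))).map (frob Fq C (i + 1)) := by
  have h0 : (e m).map (frob Fq C 0) = e m := by ext; simp
  rw [he.2 m, Finset.sum_range_succ', Nat.sub_zero, h0, add_sub_cancel_right]

theorem IsExpCoeff.tendsto_norm_mul_pow (hθ : 1 < ‖theta Fq C‖)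
    (hG : ‖G.rhoT 0 - theta Fq C • 1‖ < ‖theta Fq C‖) {e : ℕ → Matrix n n C}
    (he : G.IsExpCoeff e) (B : ℝ) :
    Tendsto (fun m => ‖e m‖ * B ^ Fintype.card Fq ^ m) atTop (𝓝 0) := by
  obtain ⟨D, hD1, hD⟩ : ∃ D : ℝ, 1 ≤ D ∧ ∀ i, ‖G.rhoT i‖ ≤ D := by
    refine ⟨1 + ∑ i ∈ G.rhoT.support, ‖G.rhoT i‖,
      le_add_of_nonneg_right (Finset.sum_nonneg fun i _ => norm_nonneg _), fun i => ?_⟩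
    by_cases hi : i ∈ G.rhoT.support
    · have := Finset.single_le_sum (fun j _ => norm_nonneg (G.rhoT j)) hi
      linarith
    · rw [Finsupp.notMem_support_iff.1 hi, norm_zero]
      positivity
  have hN (i : ℕ) (hi : G.rhoT i ≠ 0) : i ≤ G.rhoT.support.sup id :=
    Finset.le_sup (f := id) (Finsupp.mem_support_iff.2 hi)
  refine tendsto_mul_pow_of_recursion (N := G.rhoT.support.sup id + 1) Fintype.one_lt_card
    (fun m => norm_nonneg _) hθ hD1 (fun m hm => ?_) B
  obtain ⟨i, hi, hle⟩ := IsUltrametricDist.exists_norm_finsetSum_le (Finset.range m)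
    fun i => G.rhoT (i + 1) * (e (m - (i + 1))).map (frob Fq C (i + 1))
  have him : i < m := Finset.mem_range.1 (hi ⟨0, by simpa using Nat.pos_of_ne_zero hm⟩)
  rw [← he.mul_map_frob_sub m] at hle
  have h := (pow_mul_norm_le_norm_sylvester hθ hG hm (e m)).trans
    (hle.trans (norm_matrix_mul_le _ _))
  by_cases hρ : G.rhoT (i + 1) = 0
  · refine ⟨1, one_ne_zero, by omega, by omega, ?_⟩
    rw [hρ, norm_zero, zero_mul] at h
    exact h.trans (by positivity)
  · refine ⟨i + 1, i.succ_ne_zero, (hN _ hρ).trans (Nat.le_succ _), him, h.trans ?_⟩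
    exact mul_le_mul (hD _) (norm_map_frob_le _ _) (norm_nonneg _) (zero_le_one.trans hD1)

omit [IsUltrametricDist C] in
theorem IsExpCoeff.skewMul_single_zero_rhoT {e : ℕ → Matrix n n C}
    (he : G.IsExpCoeff e) :
    skewMul (matrixFrob Fq C n) e (Pi.single 0 (G.rhoT 0)) =
      skewMul (matrixFrob Fq C n) G.rhoT e := by
  funext m
  rw [skewMul_single_zero, matrixFrob_pow_apply, he.2 m, skewMul,
    Finset.Nat.sum_antidiagonal_eq_sum_range_succ_mk]
  simp only [matrixFrob_pow_apply]

omit [IsUltrametricDist C] in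
theorem IsExpCoeff.skewMul_eq_one {e P : ℕ → Matrix n n C}
    (he : G.IsExpCoeff e) (hP0 : P 0 = 1)
    (hP : skewMul (matrixFrob Fq C n) (Pi.single 0 (G.rhoT 0)) P =
      skewMul (matrixFrob Fq C n) P G.rhoT) :
    skewMul (matrixFrob Fq C n) e P = Pi.single 0 1 := by
  refine eq_single_zero_one_of_skewMul_comm (φ := matrixFrob Fq C n) (a := G.rhoT) ?_ ?_ ?_
  · simp [skewMul, he.1, hP0]
  · rw [skewMul_assoc, ← hP, ← skewMul_assoc, he.skewMul_single_zero_rhoT, skewMul_assoc]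
  · intro m hm x hx
    refine (G.sylvester_bijective m hm).1 ?_
    simpa [matrixFrob_pow_apply, sub_eq_zero] using hx

end Exponential

section BaseChange

variable {Fq : Type*} [Field Fq] [Fintype Fq] {F : Type*} [Field F] [Algebra (RatFunc Fq) F]
  {n : Type*} [Fintype n] [DecidableEq n] (G : TModule Fq F n)
  (C : Type*) [Field C] [Algebra (RatFunc Fq) C] [Algebra F C] [IsScalarTower (RatFunc Fq) F C]

/-- The `t`-module `G`, viewed over the extension `C` of `F`. -/
noncomputable def baseChange : TModule Fq C n where
  rhoT := G.rhoT.mapRange (algebraMap F C).mapMatrix (map_zero _)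
  nilpotent := by
    have hθ : theta Fq C = algebraMap F C (theta Fq F) :=
      IsScalarTower.algebraMap_apply (RatFunc Fq) F C _
    have h := G.nilpotent.map (algebraMap F C).mapMatrix
    rw [map_sub] at h
    have hsmul : (algebraMap F C).mapMatrix (theta Fq F • (1 : Matrix n n F)) = theta Fq C • 1 := by
      ext i j
      rcases eq_or_ne i j with rfl | hij
      · simp [hθ]
      · simp [hij]
    rwa [hsmul] at h

omit [Fintype Fq] in
theorem baseChange_rhoT (i : ℕ) :
    (G.baseChange C).rhoT i = (G.rhoT i).map (algebraMap F C) := rfl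

theorem isExpCoeff_baseChange :
    (G.baseChange C).IsExpCoeff fun i => (G.expCoeff i).map (algebraMap F C) := by
  have hfrob (M : Matrix n n F) (i : ℕ) : (M.map (algebraMap F C)).map (frob Fq C i) =
      (algebraMap F C).mapMatrix (M.map (frob Fq F i)) := by
    ext; simp
  constructor
  · simp [G.isExpCoeff_expCoeff.1]
  · intro m
    simp only [baseChange_rhoT, hfrob]
    simp only [← RingHom.mapMatrix_apply, ← map_mul, ← map_sum]
    exact congrArg _ (G.isExpCoeff_expCoeff.2 m)

end BaseChange

section Inversion

variable {Fq : Type*} [Field Fq] [Fintype Fq] {F : Type*} [Field F] [Algebra (RatFunc Fq) F]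
  {n : Type*} [Fintype n] [DecidableEq n] {G : TModule Fq F n}
  {C : Type*} [NormedField C] [IsUltrametricDist C] [CompleteSpace C] [Algebra (RatFunc Fq) C]
  [Algebra F C] [IsScalarTower (RatFunc Fq) F C]

theorem hasSum_expTerm_tsum_twistedMulVec (hθ : 1 < ‖theta Fq C‖)
    (hG : ‖(G.baseChange C).rhoT 0 - theta Fq C • 1‖ < ‖theta Fq C‖) {P : ℕ → Matrix n n C}
    (hP0 : P 0 = 1)
    (hP : skewMul (matrixFrob Fq C n) (Pi.single 0 ((G.baseChange C).rhoT 0)) P =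
      skewMul (matrixFrob Fq C n) P (G.baseChange C).rhoT) {c : n → C}
    (hc : Tendsto (fun j => twistedMulVec Fq (P j) j c) atTop (𝓝 0)) :
    HasSum (G.expTerm (∑' j, twistedMulVec Fq (P j) j c)) c :=
  have he := G.isExpCoeff_baseChange C
  hasSum_twistedMulVec_of_skewMul_eq_one (he.tendsto_norm_mul_pow hθ hG) hc
    (he.skewMul_eq_one hP0 hP)

end Inversion

end TModule

/-! ### The Tate algebra and jets at `t = θ` -/

section LaurentT

/-- The variable `t` of `C((t))`. -/
noncomputable def laurentT (C : Type*) [Semiring C] : LaurentSeries C :=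
  HahnSeries.single (1 : ℤ) 1

theorem coeff_laurentT_mul {C : Type*} [Semiring C] (f : LaurentSeries C) (m : ℤ) :
    (laurentT C * f).coeff m = f.coeff (m - 1) := by
  rw [laurentT, HahnSeries.coeff_single_mul, one_mul]

theorem hasseDeriv_succ_laurentT_mul {C : Type*} [CommRing C] (a : ℕ) (f : LaurentSeries C) :
    LaurentSeries.hasseDeriv C (a + 1) (laurentT C * f) =
      laurentT C * LaurentSeries.hasseDeriv C (a + 1) f + LaurentSeries.hasseDeriv C a f := by
  ext m
  simp only [HahnSeries.coeff_add, coeff_laurentT_mul, LaurentSeries.hasseDeriv_coeff]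
  rw [show m - 1 + ((a + 1 : ℕ) : ℤ) = m + a by push_cast; ring,
    show m + ((a + 1 : ℕ) : ℤ) - 1 = m + a by push_cast; ring,
    show m + ((a + 1 : ℕ) : ℤ) = (m + a) + 1 by push_cast; ring,
    Ring.choose_succ_succ, add_smul, add_comm]

theorem inv_laurentT_sub_single {C : Type*} [Field C] {α : C} (hα : α ≠ 0) :
    (laurentT C - HahnSeries.single 0 α)⁻¹ =
      -HahnSeries.ofPowerSeries ℤ C (PowerSeries.invUnitsSub (Units.mk0 α hα)) := by
  refine (eq_inv_of_mul_eq_one_left ?_).symm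
  have h := congrArg (HahnSeries.ofPowerSeries ℤ C)
    (PowerSeries.invUnitsSub_mul_sub (Units.mk0 α hα))
  rw [map_mul, map_sub, HahnSeries.ofPowerSeries_X, HahnSeries.ofPowerSeries_C,
    map_one (HahnSeries.ofPowerSeries ℤ C)] at h
  rw [neg_mul, ← mul_neg, neg_sub]
  exact h

end LaurentT

section GaussBound

variable {C : Type*} [NormedField C]

/-- `f` is a power series whose Gauss norm on the disc of radius `R` is at most `B`. The bound is
explicit, so that no supremum of a possibly unbounded set of reals occurs. -/
structure GaussBound (R B : ℝ) (f : LaurentSeries C) : Prop where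
  coeff_eq_zero : ∀ m < 0, f.coeff m = 0
  norm_coeff_mul_le : ∀ m : ℕ, ‖f.coeff m‖ * R ^ m ≤ B

namespace GaussBound

variable {R B B' : ℝ} {f g : LaurentSeries C}

theorem mono (hf : GaussBound R B f) (hB : B ≤ B') : GaussBound R B' f :=
  ⟨hf.coeff_eq_zero, fun m => (hf.norm_coeff_mul_le m).trans hB⟩

theorem bound_nonneg (hf : GaussBound R B f) : 0 ≤ B :=
  (norm_nonneg _).trans (by simpa using hf.norm_coeff_mul_le 0)

theorem zero (hB : 0 ≤ B) : GaussBound R B (0 : LaurentSeries C) :=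
  ⟨fun m _ => by simp, fun m => by simpa using hB⟩

theorem single_zero (c : C) : GaussBound R ‖c‖ (HahnSeries.single (0 : ℤ) c) := by
  refine ⟨fun m hm => HahnSeries.coeff_single_of_ne hm.ne, fun m => ?_⟩
  rcases Nat.eq_zero_or_pos m with rfl | hm
  · simp
  · rw [HahnSeries.coeff_single_of_ne (by omega)]
    simp

theorem one : GaussBound R 1 (1 : LaurentSeries C) := by
  simpa using single_zero (R := R) (1 : C)

theorem neg (hf : GaussBound R B f) : GaussBound R B (-f) :=
  ⟨fun m hm => by simp [hf.coeff_eq_zero m hm], fun m => by simpa using hf.norm_coeff_mul_le m⟩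

variable [IsUltrametricDist C]

theorem add (hR : 0 ≤ R) (hf : GaussBound R B f) (hg : GaussBound R B g) :
    GaussBound R B (f + g) := by
  refine ⟨fun m hm => by simp [hf.coeff_eq_zero m hm, hg.coeff_eq_zero m hm], fun m => ?_⟩
  calc ‖f.coeff m + g.coeff m‖ * R ^ m ≤ max ‖f.coeff m‖ ‖g.coeff m‖ * R ^ m := by
        gcongr
        exact IsUltrametricDist.norm_add_le_max _ _
    _ ≤ B := by
        rw [max_mul_of_nonneg _ _ (pow_nonneg hR m)]
        exact max_le (hf.norm_coeff_mul_le m) (hg.norm_coeff_mul_le m)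

theorem sub (hR : 0 ≤ R) (hf : GaussBound R B f) (hg : GaussBound R B g) :
    GaussBound R B (f - g) :=
  sub_eq_add_neg f g ▸ hf.add hR hg.neg

theorem sum {ι : Type*} {S : Finset ι} {F : ι → LaurentSeries C} (hR : 0 ≤ R) (hB : 0 ≤ B)
    (h : ∀ i ∈ S, GaussBound R B (F i)) : GaussBound R B (∑ i ∈ S, F i) :=
  Finset.sum_induction F (GaussBound R B) (fun _ _ => add hR) (zero hB) h

theorem mul (hR : 0 < R) (hf : GaussBound R B f) (hg : GaussBound R B' g) :
    GaussBound R (B * B') (f * g) := by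
  refine ⟨fun m hm => ?_, fun m => ?_⟩ <;> rw [HahnSeries.coeff_mul]
  · refine Finset.sum_eq_zero fun ij hij => ?_
    have hadd := (Finset.mem_antidiagonal.1 hij).2.2
    by_cases h : ij.1 < 0
    · rw [hf.coeff_eq_zero _ h, zero_mul]
    · rw [hg.coeff_eq_zero _ (by omega), mul_zero]
  · rw [← le_div_iff₀ (pow_pos hR m)]
    refine IsUltrametricDist.norm_sum_le_of_forall_le_of_nonneg
      (div_nonneg (mul_nonneg hf.bound_nonneg hg.bound_nonneg) (pow_pos hR m).le)
      fun ⟨i, j⟩ hij => ?_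
    obtain ⟨hi, hj, hadd⟩ := Finset.mem_antidiagonal.1 hij
    lift i to ℕ using not_lt.1 fun h => hi (hf.coeff_eq_zero _ h)
    lift j to ℕ using not_lt.1 fun h => hj (hg.coeff_eq_zero _ h)
    obtain rfl : i + j = m := Int.ofNat_inj.1 hadd
    rw [le_div_iff₀ (pow_pos hR _), norm_mul, pow_add]
    calc ‖f.coeff i‖ * ‖g.coeff j‖ * (R ^ i * R ^ j)
        = ‖f.coeff i‖ * R ^ i * (‖g.coeff j‖ * R ^ j) := by ring
      _ ≤ B * B' := mul_le_mul (hf.norm_coeff_mul_le i) (hg.norm_coeff_mul_le j) (by positivity)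
          hf.bound_nonneg

theorem pow (hR : 0 < R) (hf : GaussBound R B f) (n : ℕ) : GaussBound R (B ^ n) (f ^ n) := by
  induction n with
  | zero => simpa using one
  | succ n ih => rw [pow_succ, pow_succ]; exact ih.mul hR hf

theorem hasseDeriv (hR : 1 ≤ R) (hf : GaussBound R B f) (a : ℕ) :
    GaussBound R B (LaurentSeries.hasseDeriv C a f) := by
  refine ⟨fun m hm => ?_, fun m => ?_⟩ <;> rw [LaurentSeries.hasseDeriv_coeff]
  · by_cases h : m + a < 0
    · rw [hf.coeff_eq_zero _ h, smul_zero]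
    · obtain ⟨i, hi⟩ := Int.eq_ofNat_of_zero_le (not_lt.1 h)
      rw [hi, Ring.choose_natCast, Nat.choose_eq_zero_of_lt (by omega), Nat.cast_zero, zero_smul]
  · rw [← Nat.cast_add, Ring.choose_natCast, natCast_zsmul, nsmul_eq_mul, norm_mul]
    refine le_trans ?_ (hf.norm_coeff_mul_le (m + a))
    gcongr
    · exact mul_le_of_le_one_left (norm_nonneg _) (IsUltrametricDist.norm_natCast_le_one C _)
    · exact Nat.le_add_right m a

end GaussBound

theorem gaussBound_laurentT {R : ℝ} (hR : 0 ≤ R) : GaussBound R R (laurentT C) := by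
  refine ⟨fun m hm => HahnSeries.coeff_single_of_ne (by omega), fun m => ?_⟩
  rcases eq_or_ne m 1 with rfl | hm
  · simp [laurentT]
  · rw [laurentT, HahnSeries.coeff_single_of_ne (by omega)]
    simpa using hR

theorem gaussBound_laurentT_sub_single [IsUltrametricDist C] {R : ℝ} {α : C} (hR : 0 ≤ R)
    (hα : R ≤ ‖α‖) : GaussBound R ‖α‖ (laurentT C - HahnSeries.single 0 α) :=
  ((gaussBound_laurentT hR).mono hα).sub hR (GaussBound.single_zero α)

theorem gaussBound_inv_laurentT_sub_single {R : ℝ} {α : C} (hR : 0 < R) (hα : R ≤ ‖α‖) :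
    GaussBound R ‖α‖⁻¹ (laurentT C - HahnSeries.single 0 α)⁻¹ := by
  rw [inv_laurentT_sub_single (norm_pos_iff.1 (hR.trans_le hα))]
  refine GaussBound.neg ⟨fun m hm => ?_, fun m => ?_⟩
  · rw [HahnSeries.ofPowerSeries_apply, HahnSeries.embDomain_of_notMem_range]
    rintro ⟨x, rfl⟩
    exact absurd hm (by simp)
  · rw [HahnSeries.ofPowerSeries_apply_coeff, PowerSeries.coeff_invUnitsSub, one_divp]
    simp only [Units.val_inv_eq_inv_val, Units.val_pow_eq_pow_val, Units.val_mk0, norm_inv,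
      norm_pow]
    have hα0 := hR.trans_le hα
    rw [inv_mul_le_iff₀ (by positivity), pow_succ, mul_inv_cancel_right₀ hα0.ne']
    gcongr

end GaussBound

section Jet

variable {Fq : Type*} [Field Fq] {C : Type*} [NormedField C]
  [Algebra (RatFunc Fq) C] {R B : ℝ} {f g : LaurentSeries C}

theorem GaussBound.inTate (hf : GaussBound R B f) (hR : ‖theta Fq C‖ < R) : InTate Fq C f := by
  refine ⟨hf.coeff_eq_zero, ?_⟩
  have hR0 : 0 < R := (norm_nonneg _).trans_lt hR
  have hlim : Tendsto (fun m : ℕ => B * (‖theta Fq C‖ / R) ^ m) atTop (𝓝 0) := by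
    simpa using (tendsto_pow_atTop_nhds_zero_of_lt_one (by positivity)
      ((div_lt_one hR0).2 hR)).const_mul B
  refine squeeze_zero (fun _ => norm_nonneg _) (fun m => ?_) hlim
  rw [norm_mul, norm_pow, div_pow, ← mul_div_assoc, le_div_iff₀ (pow_pos hR0 m), mul_right_comm]
  gcongr
  exact hf.norm_coeff_mul_le m

theorem GaussBound.norm_evalTheta_le [IsUltrametricDist C] (hf : GaussBound R B f)
    (hR : ‖theta Fq C‖ ≤ R) : ‖evalTheta Fq C f‖ ≤ B := by
  refine IsUltrametricDist.norm_tsum_le_of_forall_le_of_nonneg hf.bound_nonneg fun m => ?_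
  rw [norm_mul, norm_pow]
  refine le_trans ?_ (hf.norm_coeff_mul_le m)
  gcongr

theorem inTate_iff : InTate Fq C f ↔ (∀ m < 0, f.coeff m = 0) ∧
    Tendsto (fun m : ℕ => f.coeff m * theta Fq C ^ m) atTop (𝓝 0) :=
  and_congr_right' tendsto_zero_iff_norm_tendsto_zero.symm

namespace InTate

theorem add (hf : InTate Fq C f) (hg : InTate Fq C g) : InTate Fq C (f + g) := by
  rw [inTate_iff] at *
  refine ⟨fun m hm => by simp [hf.1 m hm, hg.1 m hm], ?_⟩
  simpa [add_mul] using hf.2.add hg.2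

theorem single_zero_mul (c : C) (hf : InTate Fq C f) :
    InTate Fq C (HahnSeries.single 0 c * f) := by
  rw [inTate_iff] at *
  refine ⟨fun m hm => by simp [hf.1 m hm], ?_⟩
  simpa [mul_assoc] using hf.2.const_mul c

theorem laurentT_mul (hf : InTate Fq C f) : InTate Fq C (laurentT C * f) := by
  rw [inTate_iff] at *
  refine ⟨fun m hm => by rw [coeff_laurentT_mul, hf.1 _ (by omega)], ?_⟩
  rw [← tendsto_add_atTop_iff_nat 1]
  simpa [coeff_laurentT_mul, pow_succ, mul_assoc] using hf.2.mul_const (theta Fq C)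

theorem hasseDeriv [IsUltrametricDist C] (hθ : 1 ≤ ‖theta Fq C‖) (hf : InTate Fq C f) (a : ℕ) :
    InTate Fq C (LaurentSeries.hasseDeriv C a f) := by
  obtain ⟨B, hB⟩ := hf.2.bddAbove_range
  have hbound : GaussBound ‖theta Fq C‖ B f := ⟨hf.1, fun m => by simpa using hB ⟨m, rfl⟩⟩
  refine ⟨(hbound.hasseDeriv hθ a).coeff_eq_zero, ?_⟩
  refine squeeze_zero (fun _ => norm_nonneg _) (fun m => ?_) ((tendsto_add_atTop_iff_nat a).2 hf.2)
  rw [LaurentSeries.hasseDeriv_coeff, ← Nat.cast_add, Ring.choose_natCast, natCast_zsmul,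
    nsmul_eq_mul, norm_mul, norm_mul, norm_mul, norm_pow, norm_pow]
  gcongr
  · exact mul_le_of_le_one_left (norm_nonneg _) (IsUltrametricDist.norm_natCast_le_one C _)
  · exact Nat.le_add_right m a

theorem summable [IsUltrametricDist C] [CompleteSpace C] (hf : InTate Fq C f) :
    Summable fun m : ℕ => f.coeff m * theta Fq C ^ m :=
  NonarchimedeanAddGroup.summable_of_tendsto_cofinite_zero
    (Nat.cofinite_eq_atTop ▸ (inTate_iff.1 hf).2)

end InTate

theorem evalTheta_single_zero_mul (c : C) (f : LaurentSeries C) :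
    evalTheta Fq C (HahnSeries.single 0 c * f) = c * evalTheta Fq C f := by
  simp [evalTheta, ← tsum_mul_left, mul_assoc]

/-- The hyperderivative `∂_t^a f` evaluated at `t = θ`, which is meaningful for `f ∈ 𝕋_θ`. -/
noncomputable def jet (Fq : Type*) [Field Fq] [Algebra (RatFunc Fq) C] (a : ℕ)
    (f : LaurentSeries C) : C :=
  evalTheta Fq C (LaurentSeries.hasseDeriv C a f)

theorem jet_zero_right (a : ℕ) : jet Fq a (0 : LaurentSeries C) = 0 := by
  simp [jet, evalTheta]

theorem jet_one (a : ℕ) : jet Fq a (1 : LaurentSeries C) = if a = 0 then 1 else 0 := by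
  rw [jet, evalTheta, tsum_eq_single 0]
  · rw [LaurentSeries.hasseDeriv_coeff]
    split_ifs with h
    · subst h; simp
    · rw [HahnSeries.coeff_one, if_neg (by simpa using h)]
      simp
  · intro m hm
    rw [LaurentSeries.hasseDeriv_coeff, HahnSeries.coeff_one, if_neg (by omega)]
    simp

theorem jet_single_zero_mul (c : C) (f : LaurentSeries C) (a : ℕ) :
    jet Fq a (HahnSeries.single 0 c * f) = c * jet Fq a f := by
  rw [jet, jet, ← evalTheta_single_zero_mul]
  congr 1
  ext m
  simp

variable [IsUltrametricDist C]

theorem GaussBound.norm_jet_le (hf : GaussBound R B f) (hR1 : 1 ≤ R) (hR : ‖theta Fq C‖ ≤ R)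
    (a : ℕ) : ‖jet Fq a f‖ ≤ B :=
  (hf.hasseDeriv hR1 a).norm_evalTheta_le hR

variable [CompleteSpace C]

theorem evalTheta_add (hf : InTate Fq C f) (hg : InTate Fq C g) :
    evalTheta Fq C (f + g) = evalTheta Fq C f + evalTheta Fq C g := by
  simp [evalTheta, ← hf.summable.tsum_add hg.summable, add_mul]

theorem evalTheta_laurentT_mul (hf : InTate Fq C f) :
    evalTheta Fq C (laurentT C * f) = theta Fq C * evalTheta Fq C f := by
  rw [evalTheta, hf.laurentT_mul.summable.tsum_eq_zero_add, evalTheta, ← tsum_mul_left]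
  simp [coeff_laurentT_mul, hf.1, pow_succ', mul_left_comm]

theorem jet_zero_laurentT_mul (hf : InTate Fq C f) :
    jet Fq 0 (laurentT C * f) = theta Fq C * jet Fq 0 f := by
  simp only [jet, LaurentSeries.hasseDeriv_zero, LinearMap.id_apply]
  exact evalTheta_laurentT_mul hf

variable (hθ : 1 ≤ ‖theta Fq C‖)
include hθ

theorem jet_add (hf : InTate Fq C f) (hg : InTate Fq C g) (a : ℕ) :
    jet Fq a (f + g) = jet Fq a f + jet Fq a g := by
  rw [jet, map_add, evalTheta_add (hf.hasseDeriv hθ a) (hg.hasseDeriv hθ a), jet, jet]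

theorem jet_succ_laurentT_mul (hf : InTate Fq C f) (a : ℕ) :
    jet Fq (a + 1) (laurentT C * f) = theta Fq C * jet Fq (a + 1) f + jet Fq a f := by
  rw [jet, hasseDeriv_succ_laurentT_mul,
    evalTheta_add (hf.hasseDeriv hθ (a + 1)).laurentT_mul (hf.hasseDeriv hθ a),
    evalTheta_laurentT_mul (hf.hasseDeriv hθ (a + 1)), jet, jet]

theorem jet_sub_theta_mul (hf : InTate Fq C f) (a : ℕ) :
    jet Fq a ((laurentT C - HahnSeries.single 0 (theta Fq C)) * f) =
      jet Fq a (laurentT C * f) - theta Fq C * jet Fq a f := by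
  rw [sub_mul, sub_eq_add_neg, ← neg_mul, ← HahnSeries.single_neg,
    jet_add hθ hf.laurentT_mul (hf.single_zero_mul _), jet_single_zero_mul, neg_mul,
    sub_eq_add_neg]

theorem jet_sub_theta_pow_mul (hf : InTate Fq C f) (a d : ℕ) :
    jet Fq a ((laurentT C - HahnSeries.single 0 (theta Fq C)) ^ d * f) =
      if d ≤ a then jet Fq (a - d) f else 0 := by
  induction d generalizing a f with
  | zero => simp
  | succ d ih =>
    have hg : InTate Fq C ((laurentT C - HahnSeries.single 0 (theta Fq C)) * f) := by
      rw [sub_mul, sub_eq_add_neg, ← neg_mul, ← HahnSeries.single_neg]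
      exact hf.laurentT_mul.add (hf.single_zero_mul _)
    rw [pow_succ, mul_assoc, ih hg]
    rcases lt_trichotomy a d with had | rfl | had
    · rw [if_neg (by omega), if_neg (by omega)]
    · rw [if_pos le_rfl, if_neg (by omega), Nat.sub_self, jet_sub_theta_mul hθ hf,
        jet_zero_laurentT_mul hf, sub_self]
    · obtain ⟨e, rfl⟩ := Nat.exists_eq_add_of_lt had
      rw [if_pos (by omega), if_pos (by omega), jet_sub_theta_mul hθ hf,
        show d + e + 1 - d = e + 1 by omega, jet_succ_laurentT_mul hθ hf,
        add_sub_cancel_left, Nat.add_sub_add_right, Nat.add_sub_cancel_left]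

end Jet

/-! ### The products `Θ^{(1)} ⋯ Θ^{(n)}` -/

section Twist

variable (Fq : Type*) [Field Fq] [Fintype Fq] (F : Type*) [Field F]
  (C : Type*) [NormedField C] [Algebra (RatFunc Fq) C] [Algebra F C]

/-- The twist `f ↦ f^{(n)}` as a ring endomorphism of `C((t))`. -/
def laurentTwistHom (n : ℕ) : LaurentSeries C →+* LaurentSeries C where
  toFun := laurentTwist Fq C n
  map_one' := HahnSeries.map_one (frob Fq C n).toMonoidWithZeroHom
  map_mul' _ _ := HahnSeries.map_mul (frob Fq C n : C →ₙ+* C)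
  map_zero' := HahnSeries.map_zero (frob Fq C n : ZeroHom C C)
  map_add' _ _ := HahnSeries.map_add (frob Fq C n : C →+ C)

/-- The map `f ↦ f^{(n)}` from `F[t]` to `C((t))`. -/
noncomputable def polyTwist (n : ℕ) : F[X] →+* LaurentSeries C :=
  (laurentTwistHom Fq C n).comp (toLaurent F C)

variable {Fq F C}

theorem toLaurent_injective : Function.Injective (toLaurent F C) := by
  refine (HahnSeries.ofPowerSeries_injective.comp (Polynomial.coe_injective C)).comp ?_
  exact Polynomial.map_injective _ (algebraMap F C).injective

theorem coeff_polyTwist (n : ℕ) (p : F[X]) (m : ℕ) :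
    (polyTwist Fq F C n p).coeff m = algebraMap F C (p.coeff m) ^ (Fintype.card Fq ^ n) := by
  change frob Fq C n ((HahnSeries.ofPowerSeries ℤ C _).coeff (m : ℤ)) = _
  rw [HahnSeries.ofPowerSeries_apply_coeff]
  simp [Polynomial.coeToPowerSeries.ringHom]

theorem coeff_polyTwist_of_neg (n : ℕ) (p : F[X]) {m : ℤ} (hm : m < 0) :
    (polyTwist Fq F C n p).coeff m = 0 := by
  change frob Fq C n ((HahnSeries.ofPowerSeries ℤ C _).coeff m) = 0
  rw [HahnSeries.ofPowerSeries_apply, HahnSeries.embDomain_of_notMem_range, map_zero]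
  rintro ⟨x, rfl⟩
  exact absurd hm (by simp)

theorem polyTwist_eq {n : ℕ} {p : F[X]} {f : LaurentSeries C} (hf : ∀ m < 0, f.coeff m = 0)
    (h : ∀ m : ℕ, algebraMap F C (p.coeff m) ^ (Fintype.card Fq ^ n) = f.coeff m) :
    polyTwist Fq F C n p = f := by
  ext m
  rcases lt_or_ge m 0 with hm | hm
  · rw [hf m hm, coeff_polyTwist_of_neg n p hm]
  · lift m to ℕ using hm
    exact (coeff_polyTwist n p m).trans (h m)

theorem polyTwist_X (n : ℕ) : polyTwist Fq F C n X = laurentT C := by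
  refine polyTwist_eq (fun m hm => HahnSeries.coeff_single_of_ne (by omega)) fun m => ?_
  rcases eq_or_ne m 1 with rfl | hm
  · simp [laurentT]
  · rw [laurentT, HahnSeries.coeff_single_of_ne (by omega), Polynomial.coeff_X_of_ne_one hm,
      map_zero, zero_pow (pow_ne_zero _ Fintype.card_ne_zero)]

theorem polyTwist_C (n : ℕ) (x : F) : polyTwist Fq F C n (Polynomial.C x) =
    HahnSeries.single 0 (algebraMap F C x ^ (Fintype.card Fq ^ n)) := by
  refine polyTwist_eq (fun m hm => HahnSeries.coeff_single_of_ne (by omega)) fun m => ?_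
  rcases eq_or_ne m 0 with rfl | hm
  · simp
  · rw [HahnSeries.coeff_single_of_ne (by omega), Polynomial.coeff_C_of_ne_zero hm,
      map_zero, zero_pow (pow_ne_zero _ Fintype.card_ne_zero)]

theorem gaussBound_polyTwist {R : ℝ} (hR : 1 ≤ R) (n : ℕ) (p : F[X]) :
    GaussBound R (((p.map (algebraMap F C)).gaussNorm (NormedField.toAbsoluteValue C) 1) ^
      (Fintype.card Fq ^ n) * R ^ p.natDegree) (polyTwist Fq F C n p) := by
  have hnonneg := (p.map (algebraMap F C)).gaussNorm_nonneg
    (NormedField.toAbsoluteValue C) zero_le_one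
  refine ⟨fun m => coeff_polyTwist_of_neg n p, fun m => ?_⟩
  rw [coeff_polyTwist, norm_pow]
  rcases le_or_gt m p.natDegree with hm | hm
  · gcongr
    simpa [NormedField.toAbsoluteValue] using
      (p.map (algebraMap F C)).le_gaussNorm (NormedField.toAbsoluteValue C) zero_le_one m
  · rw [Polynomial.coeff_eq_zero_of_natDegree_lt hm, map_zero, norm_zero,
      zero_pow (pow_ne_zero _ Fintype.card_ne_zero), zero_mul]
    positivity

variable [Algebra (RatFunc Fq) F]

theorem polyTwist_tSubTheta [IsScalarTower (RatFunc Fq) F C] (n : ℕ) :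
    polyTwist Fq F C n (tSubTheta Fq F) =
      laurentT C - HahnSeries.single 0 (theta Fq C ^ (Fintype.card Fq ^ n)) := by
  rw [map_sub, polyTwist_X, polyTwist_C, theta, ← IsScalarTower.algebraMap_apply, theta]

theorem polyTwist_succ_rootTwist [IsAlgClosed F] (n : ℕ) (p : F[X]) :
    polyTwist Fq F C (n + 1) (rootTwist Fq F p) = polyTwist Fq F C n p := by
  refine polyTwist_eq (fun m => coeff_polyTwist_of_neg n p) fun m => ?_
  rw [coeff_polyTwist, rootTwist, Polynomial.coeff_map, pow_succ', pow_mul, ← map_pow]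
  congr 2
  exact (frobEquiv_apply Fq F _).symm.trans ((frobEquiv Fq F).apply_symm_apply _)

end Twist

section ThetaTwist

variable {Fq : Type*} [Field Fq] [Fintype Fq] {F : Type*} [Field F] [Algebra (RatFunc Fq) F]
  [IsAlgClosed F] {C : Type*} [NormedField C] [Algebra (RatFunc Fq) C] [Algebra F C]
  {k : ℕ} (s : Fin (k + 1) → ℕ+) (Q : Fin k → F[X])

theorem dSum_castSucc (j : Fin k) : dSum s j.castSucc = s j.castSucc + dSum s j.succ := by
  have hIci : Finset.Ici j.castSucc = insert j.castSucc (Finset.Ici j.succ) := by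
    ext i
    simp only [Finset.mem_Ici, Finset.mem_insert, Fin.le_def, Fin.ext_iff, Fin.val_castSucc,
      Fin.val_succ]
    omega
  rw [dSum, hIci, Finset.sum_insert (by simp), dSum]

theorem PhiPrime_self (i : Fin (k + 1)) :
    PhiPrime Fq F s Q i i = tSubTheta Fq F ^ dSum s i := by
  simp [PhiPrime]

theorem PhiPrime_succ_castSucc (j : Fin k) : PhiPrime Fq F s Q j.succ j.castSucc =
    rootTwist Fq F (Q j) * tSubTheta Fq F ^ dSum s j.castSucc := by
  simp [PhiPrime, (Fin.castSucc_lt_succ (i := j)).ne']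

theorem PhiPrime_zero_of_ne {j : Fin (k + 1)} (hj : j ≠ 0) : PhiPrime Fq F s Q 0 j = 0 := by
  simp [PhiPrime, hj.symm]

theorem PhiPrime_succ_of_ne {i : Fin k} {j : Fin (k + 1)} (hj : j ≠ i.succ)
    (hj' : j ≠ i.castSucc) : PhiPrime Fq F s Q i.succ j = 0 := by
  rw [PhiPrime, Matrix.of_apply, if_neg hj.symm, dif_neg]
  contrapose! hj'
  exact Fin.ext (Nat.succ_injective hj')

theorem det_PhiPrime_ne_zero : (PhiPrime Fq F s Q).det ≠ 0 := by
  rw [Matrix.det_of_isLowerTriangular]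
  · exact Finset.prod_ne_zero_iff.2 fun i _ => by
      rw [PhiPrime_self]
      exact pow_ne_zero _ (X_sub_C_ne_zero _)
  · intro i j (hij : i < j)
    rw [PhiPrime, Matrix.of_apply, if_neg hij.ne, dif_neg]
    have := Fin.lt_def.1 hij
    omega

variable (Fq C) in
/-- The matrix `Θ^{(n)}`. -/
noncomputable def thetaTwist (n : ℕ) : Matrix (Fin (k + 1)) (Fin (k + 1)) (LaurentSeries C) :=
  (Theta Fq F C s Q).map (laurentTwist Fq C n)

variable (Fq C) in
/-- The matrix `Θ^{(1)} ⋯ Θ^{(n)}`. -/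
noncomputable def thetaProd (n : ℕ) : Matrix (Fin (k + 1)) (Fin (k + 1)) (LaurentSeries C) :=
  ((List.range n).map fun m => thetaTwist Fq C s Q (m + 1)).prod

theorem thetaProd_zero : thetaProd Fq C s Q 0 = 1 := rfl

theorem thetaProd_succ (n : ℕ) :
    thetaProd Fq C s Q (n + 1) = thetaProd Fq C s Q n * thetaTwist Fq C s Q (n + 1) := by
  simp [thetaProd, List.range_succ]

theorem thetaTwist_mul_transpose (n : ℕ) :
    thetaTwist Fq C s Q n * ((PhiPrime Fq F s Q).map (polyTwist Fq F C n))ᵀ = 1 := by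
  have hdet : IsUnit ((PhiPrime Fq F s Q).map (toLaurent F C)).det := by
    rw [← RingHom.mapMatrix_apply, ← RingHom.map_det]
    exact IsUnit.mk0 _ ((map_ne_zero_iff _ toLaurent_injective).2 (det_PhiPrime_ne_zero s Q))
  have hTheta : Theta Fq F C s Q * ((PhiPrime Fq F s Q).map (toLaurent F C))ᵀ = 1 := by
    rw [Theta, ← Matrix.transpose_mul, Matrix.mul_nonsing_inv _ hdet, Matrix.transpose_one]
  have htwist := congrArg (laurentTwistHom Fq C n).mapMatrix hTheta
  rwa [map_mul, map_one] at htwist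

theorem thetaTwist_zero_column (n : ℕ) (i : Fin (k + 1)) :
    thetaTwist Fq C s Q n i 0 * polyTwist Fq F C n (tSubTheta Fq F) ^ dSum s 0 =
      if i = 0 then 1 else 0 := by
  have h := congrFun₂ (thetaTwist_mul_transpose (Fq := Fq) (C := C) s Q n) i 0
  rw [Matrix.mul_apply, Finset.sum_eq_single 0, Matrix.one_apply] at h
  · rw [← h, Matrix.transpose_apply, Matrix.map_apply, PhiPrime_self, map_pow]
  · intro j _ hj
    rw [Matrix.transpose_apply, Matrix.map_apply, PhiPrime_zero_of_ne s Q hj, map_zero, mul_zero]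
  · simp

theorem thetaTwist_succ_column (n : ℕ) (i : Fin (k + 1)) (j : Fin k) :
    thetaTwist Fq C s Q (n + 1) i j.succ *
        polyTwist Fq F C (n + 1) (tSubTheta Fq F) ^ dSum s j.succ =
      (if i = j.succ then 1 else 0) - thetaTwist Fq C s Q (n + 1) i j.castSucc *
        polyTwist Fq F C (n + 1) (tSubTheta Fq F) ^ dSum s j.castSucc *
          polyTwist Fq F C n (Q j) := by
  have h := congrFun₂ (thetaTwist_mul_transpose (Fq := Fq) (C := C) s Q (n + 1)) i j.succ
  rw [Matrix.mul_apply, Finset.sum_eq_add j.succ j.castSucc (Fin.castSucc_lt_succ (i := j)).ne',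
    Matrix.one_apply] at h
  · rw [← h, Matrix.transpose_apply, Matrix.map_apply, PhiPrime_self, map_pow,
      Matrix.transpose_apply, Matrix.map_apply, PhiPrime_succ_castSucc, map_mul, map_pow,
      polyTwist_succ_rootTwist]
    ring
  · intro l _ hl
    rw [Matrix.transpose_apply, Matrix.map_apply, PhiPrime_succ_of_ne s Q hl.1 hl.2, map_zero,
      mul_zero]
  · simp
  · simp

end ThetaTwist

section Growth

variable (Fq : Type*) [Field Fq] [Fintype Fq] (C : Type*) [NormedField C] [Algebra (RatFunc Fq) C]

/-- The absolute value `|θ|^{q/(q-1)}` of the Carlitz period. -/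
noncomputable def carlitzPeriodNorm : ℝ :=
  ‖theta Fq C‖ ^ ((Fintype.card Fq : ℝ) / ((Fintype.card Fq : ℝ) - 1))

variable {Fq C}

theorem carlitzPeriodNorm_pos (hθ : 1 < ‖theta Fq C‖) : 0 < carlitzPeriodNorm Fq C :=
  Real.rpow_pos_of_pos (zero_lt_one.trans hθ) _

theorem carlitzPeriodNorm_pow (d : ℕ) : carlitzPeriodNorm Fq C ^ d =
    ‖theta Fq C‖ ^ ((d : ℝ) * Fintype.card Fq / ((Fintype.card Fq : ℝ) - 1)) := by
  rw [carlitzPeriodNorm, ← Real.rpow_mul_natCast (norm_nonneg _), mul_comm, mul_div_assoc]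

theorem carlitzPeriodNorm_pow_card_pow_succ (hθ : 1 < ‖theta Fq C‖) (n : ℕ) :
    carlitzPeriodNorm Fq C ^ (Fintype.card Fq ^ (n + 1)) =
      carlitzPeriodNorm Fq C ^ (Fintype.card Fq ^ n) *
        ‖theta Fq C‖ ^ (Fintype.card Fq ^ (n + 1)) := by
  have hθ0 : 0 < ‖theta Fq C‖ := zero_lt_one.trans hθ
  have hq : (1 : ℝ) < Fintype.card Fq := by exact_mod_cast Fintype.one_lt_card
  have hcard : carlitzPeriodNorm Fq C ^ Fintype.card Fq =
      carlitzPeriodNorm Fq C * ‖theta Fq C‖ ^ Fintype.card Fq := by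
    rw [carlitzPeriodNorm, ← Real.rpow_mul_natCast hθ0.le, ← Real.rpow_natCast ‖theta Fq C‖,
      ← Real.rpow_add hθ0]
    congr 1
    have : (Fintype.card Fq : ℝ) - 1 ≠ 0 := (sub_pos.2 hq).ne'
    field_simp
    ring
  rw [pow_succ', pow_mul, hcard, mul_pow, ← pow_mul]

variable {F : Type*} [Field F] {k : ℕ} (s : Fin (k + 1) → ℕ+) (Q : Fin k → F[X])

variable (Fq C) in
/-- The growth rate `|θ|^{q δ j} / |π̃|^{dⱼ qⁿ}`, with `π̃` the Carlitz period and `δ` a bound of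
the degrees of the `Qᵢ`. The Gauss norm of the entry `(i, j)` of `Θ^{(n + 1)}` on the disc of radius
`|θ|^q` is at most the weight of `(n + 1, j)` divided by that of `(n, i)`, so that these bounds
telescope in the product `Θ^{(1)} ⋯ Θ^{(n)}`. -/
noncomputable def thetaWeight (n : ℕ) (j : Fin (k + 1)) : ℝ :=
  (‖theta Fq C‖ ^ Fintype.card Fq) ^ ((Finset.univ.sup fun i => (Q i).natDegree) * (j : ℕ)) /
    (carlitzPeriodNorm Fq C ^ dSum s j) ^ (Fintype.card Fq ^ n)

theorem thetaWeight_pos (hθ : 1 < ‖theta Fq C‖) (n : ℕ) (j : Fin (k + 1)) :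
    0 < thetaWeight Fq C s Q n j := by
  have : 0 < ‖theta Fq C‖ := zero_lt_one.trans hθ
  have hγ := carlitzPeriodNorm_pos hθ
  unfold thetaWeight
  positivity

theorem thetaWeight_succ_left (hθ : 1 < ‖theta Fq C‖) (n : ℕ) (j : Fin (k + 1)) :
    thetaWeight Fq C s Q (n + 1) j =
      thetaWeight Fq C s Q n j * (‖theta Fq C ^ (Fintype.card Fq ^ (n + 1))‖⁻¹) ^ dSum s j := by
  rw [thetaWeight, pow_right_comm _ (dSum s j), carlitzPeriodNorm_pow_card_pow_succ hθ, mul_pow,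
    thetaWeight, pow_right_comm _ (dSum s j), norm_pow, inv_pow, ← div_eq_mul_inv, div_div]

theorem thetaWeight_succ_right (hθ : 1 < ‖theta Fq C‖) (n : ℕ) (j : Fin k) :
    thetaWeight Fq C s Q n j.succ = thetaWeight Fq C s Q n j.castSucc *
      ((carlitzPeriodNorm Fq C ^ (s j.castSucc : ℕ)) ^ (Fintype.card Fq ^ n) *
        (‖theta Fq C‖ ^ Fintype.card Fq) ^ Finset.univ.sup fun i => (Q i).natDegree) := by
  have hγ := (carlitzPeriodNorm_pos hθ).ne'
  rw [thetaWeight, thetaWeight, dSum_castSucc, Fin.val_succ, Fin.val_castSucc, mul_add_one,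
    pow_add _ _ (Finset.univ.sup _), pow_add _ _ (dSum s j.succ), mul_pow]
  field_simp

variable {s Q} [Algebra F C] [Algebra (RatFunc Fq) F] [IsAlgClosed F] [IsUltrametricDist C]
  (hθ : 1 < ‖theta Fq C‖)
  (hQ : ∀ j, ((Q j).map (algebraMap F C)).gaussNorm (NormedField.toAbsoluteValue C) 1 ≤
    carlitzPeriodNorm Fq C ^ (s j.castSucc : ℕ))
include hθ hQ

theorem gaussBound_thetaTwist_mul (n : ℕ) (i j : Fin (k + 1)) :
    GaussBound (‖theta Fq C‖ ^ Fintype.card Fq)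
      (thetaWeight Fq C s Q n j / thetaWeight Fq C s Q n i)
      (thetaTwist Fq C s Q (n + 1) i j *
        polyTwist Fq F C (n + 1) (tSubTheta Fq F) ^ dSum s j) := by
  have hR0 : 0 < ‖theta Fq C‖ ^ Fintype.card Fq := pow_pos (zero_lt_one.trans hθ) _
  have hR1 : 1 ≤ ‖theta Fq C‖ ^ Fintype.card Fq := one_le_pow₀ hθ.le
  have hpos := thetaWeight_pos s Q hθ n
  have hdelta (j : Fin (k + 1)) : GaussBound (‖theta Fq C‖ ^ Fintype.card Fq)
      (thetaWeight Fq C s Q n j / thetaWeight Fq C s Q n i)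
      (if i = j then 1 else 0 : LaurentSeries C) := by
    split_ifs with hij
    · rw [hij, div_self (hpos j).ne']
      exact GaussBound.one
    · exact GaussBound.zero (div_pos (hpos j) (hpos i)).le
  induction j using Fin.induction with
  | zero =>
    rw [thetaTwist_zero_column]
    exact hdelta 0
  | succ j ih =>
    rw [thetaTwist_succ_column]
    refine (hdelta j.succ).sub hR0.le ((ih.mul hR0 (gaussBound_polyTwist hR1 n (Q j))).mono ?_)
    rw [thetaWeight_succ_right s Q hθ, mul_div_right_comm]
    have hQ0 := ((Q j).map (algebraMap F C)).gaussNorm_nonneg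
      (NormedField.toAbsoluteValue C) zero_le_one
    have := div_pos (hpos j.castSucc) (hpos i)
    have hγ := carlitzPeriodNorm_pos hθ
    gcongr
    · exact hQ j
    · exact Finset.le_sup (f := fun i => (Q i).natDegree) (Finset.mem_univ j)

variable [IsScalarTower (RatFunc Fq) F C]

theorem gaussBound_thetaTwist (n : ℕ) (i j : Fin (k + 1)) :
    GaussBound (‖theta Fq C‖ ^ Fintype.card Fq)
      (thetaWeight Fq C s Q (n + 1) j / thetaWeight Fq C s Q n i)
      (thetaTwist Fq C s Q (n + 1) i j) := by
  have hR0 : 0 < ‖theta Fq C‖ ^ Fintype.card Fq := pow_pos (zero_lt_one.trans hθ) _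
  have hR : ‖theta Fq C‖ ^ Fintype.card Fq ≤ ‖theta Fq C ^ (Fintype.card Fq ^ (n + 1))‖ := by
    rw [norm_pow]
    exact pow_le_pow_right₀ hθ.le (Nat.le_self_pow (Nat.succ_ne_zero n) _)
  have hne : (polyTwist Fq F C (n + 1) (tSubTheta Fq F)) ^ dSum s j ≠ 0 := by
    refine pow_ne_zero _ ((map_ne_zero_iff _ ?_).2 (X_sub_C_ne_zero _))
    exact (laurentTwistHom Fq C (n + 1)).injective.comp toLaurent_injective
  have h := (gaussBound_thetaTwist_mul hθ hQ n i j).mul hR0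
    ((gaussBound_inv_laurentT_sub_single hR0 hR).pow hR0 (dSum s j))
  rw [← polyTwist_tSubTheta (F := F), inv_pow (polyTwist _ _ _ _ _), mul_inv_cancel_right₀ hne,
    div_mul_eq_mul_div, ← thetaWeight_succ_left s Q hθ] at h
  exact h

theorem gaussBound_thetaProd (n : ℕ) (i j : Fin (k + 1)) :
    GaussBound (‖theta Fq C‖ ^ Fintype.card Fq)
      (thetaWeight Fq C s Q n j / thetaWeight Fq C s Q 0 i) (thetaProd Fq C s Q n i j) := by
  have hR0 : 0 < ‖theta Fq C‖ ^ Fintype.card Fq := pow_pos (zero_lt_one.trans hθ) _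
  have hpos := thetaWeight_pos s Q hθ
  induction n generalizing j with
  | zero =>
    rw [thetaProd_zero, Matrix.one_apply]
    split_ifs with hij
    · rw [hij, div_self (hpos 0 j).ne']
      exact GaussBound.one
    · exact GaussBound.zero (div_pos (hpos 0 j) (hpos 0 i)).le
  | succ n ih =>
    rw [thetaProd_succ, Matrix.mul_apply]
    refine GaussBound.sum hR0.le (div_pos (hpos _ j) (hpos 0 i)).le fun l _ => ?_
    have h := (ih l).mul hR0 (gaussBound_thetaTwist hθ hQ n l j)
    rwa [div_mul_div_comm, mul_comm (thetaWeight Fq C s Q 0 i), mul_div_mul_left _ _ (hpos n l).ne']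
      at h

end Growth

/-! ### The functional equation of the logarithm -/

section ThetaVec

variable (Fq : Type*) [Field Fq] [Fintype Fq] {F : Type*} [Field F] [Algebra (RatFunc Fq) F]
  [IsAlgClosed F] (C : Type*) [NormedField C] [Algebra (RatFunc Fq) C] [Algebra F C]
  {k : ℕ} (s : Fin (k + 1) → ℕ+) (Q : Fin k → F[X])

/-- The map `a ↦ Θ^{(1)} ⋯ Θ^{(n)} (a^{(n)})^tr` on the dual `t`-motive `M'`. -/
noncomputable def thetaVec (n : ℕ) :
    (Fin (k + 1) → F[X]) →+ (Fin (k + 1) → LaurentSeries C) where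
  toFun a := thetaProd Fq C s Q n *ᵥ (polyTwist Fq F C n ∘ a)
  map_zero' := by
    rw [← Matrix.mulVec_zero (thetaProd Fq C s Q n)]
    congr 1
    ext1
    exact map_zero _
  map_add' a b := by
    rw [← Matrix.mulVec_add]
    congr 1
    ext1
    exact map_add _ _ _

/-- The hyperderivatives at `t = θ` of `Θ^{(1)} ⋯ Θ^{(n)} (a^{(n)})^tr`, arranged as by the
operator `D`. -/
noncomputable def thetaJet (n : ℕ) (a : Fin (k + 1) → F[X]) : Idx s → C := fun l =>
  jet Fq (dSum s l.1 - 1 - l.2) (thetaVec Fq C s Q n a l.1)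

/-- The coefficient `D((Θ^{(1)} ⋯ Θ^{(n)}) X^{(n)})|_{t = θ}` of `c^{(n)}` in the logarithm. -/
noncomputable def logCoeff (n : ℕ) : Matrix (Idx s) (Idx s) C :=
  (logMatrix Fq F C s Q n).map (evalTheta Fq C)

variable {Fq C s Q}

theorem thetaVec_zero (a : Fin (k + 1) → F[X]) :
    thetaVec Fq C s Q 0 a = polyTwist Fq F C 0 ∘ a :=
  Matrix.one_mulVec _

theorem thetaVec_smul (n : ℕ) (p : F[X]) (a : Fin (k + 1) → F[X]) :
    thetaVec Fq C s Q n (p • a) = polyTwist Fq F C n p • thetaVec Fq C s Q n a := by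
  change thetaProd Fq C s Q n *ᵥ _ =
    polyTwist Fq F C n p • thetaProd Fq C s Q n *ᵥ (polyTwist Fq F C n ∘ a)
  rw [← Matrix.mulVec_smul]
  congr 1
  ext1 i
  exact map_mul _ _ _

theorem thetaVec_sigma (n : ℕ) (a : Fin (k + 1) → F[X]) :
    thetaVec Fq C s Q (n + 1) (sigma Fq F s Q a) = thetaVec Fq C s Q n a := by
  have hsigma : polyTwist Fq F C (n + 1) ∘ sigma Fq F s Q a =
      ((PhiPrime Fq F s Q).map (polyTwist Fq F C (n + 1)))ᵀ *ᵥ (polyTwist Fq F C n ∘ a) := by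
    rw [Matrix.mulVec_transpose]
    funext i
    rw [Function.comp_apply, sigma, RingHom.map_vecMul]
    have htwist : polyTwist Fq F C (n + 1) ∘ (fun j => rootTwist Fq F (a j)) =
        polyTwist Fq F C n ∘ a := funext fun j => polyTwist_succ_rootTwist n (a j)
    rw [← htwist]
  change thetaProd Fq C s Q (n + 1) *ᵥ _ = thetaProd Fq C s Q n *ᵥ _
  rw [hsigma, thetaProd_succ, ← Matrix.mulVec_mulVec, Matrix.mulVec_mulVec _ (thetaTwist _ _ _ _ _),
    thetaTwist_mul_transpose, Matrix.one_mulVec]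

theorem thetaVec_sigmaBasis (n : ℕ) (m : Idx s) (i : Fin (k + 1)) :
    thetaVec Fq C s Q n (sigmaBasis Fq F s m) i =
      thetaProd Fq C s Q n i m.1 *
        polyTwist Fq F C n (tSubTheta Fq F) ^ (dSum s m.1 - 1 - m.2) := by
  change ∑ j, _ * polyTwist Fq F C n (sigmaBasis Fq F s m j) = _
  rw [Finset.sum_eq_single m.1]
  · rw [sigmaBasis, Pi.single_eq_same, map_pow]
  · intro j _ hj
    rw [sigmaBasis, Pi.single_eq_of_ne hj, map_zero, mul_zero]
  · simp

theorem logMatrix_apply (n : ℕ) (l m : Idx s) : logMatrix Fq F C s Q n l m =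
    LaurentSeries.hasseDeriv C (dSum s l.1 - 1 - l.2)
      (thetaVec Fq C s Q n (sigmaBasis Fq F s m) l.1) := by
  rw [logMatrix, DOp, Matrix.of_apply, Matrix.mul_apply, thetaVec_sigmaBasis,
    Finset.sum_eq_single m.1]
  · rw [Matrix.map_apply, XMat, Matrix.of_apply, if_pos rfl, ← map_pow]
    rfl
  · intro j _ hj
    rw [Matrix.map_apply, XMat, Matrix.of_apply, if_neg hj]
    exact mul_eq_zero_of_right _ (laurentTwistHom Fq C n).map_zero
  · simp

theorem logCoeff_apply (n : ℕ) (l m : Idx s) :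
    logCoeff Fq C s Q n l m = thetaJet Fq C s Q n (sigmaBasis Fq F s m) l := by
  rw [logCoeff, Matrix.map_apply, logMatrix_apply, thetaJet, jet]

theorem thetaJet_succ_sigma (n : ℕ) (a : Fin (k + 1) → F[X]) :
    thetaJet Fq C s Q (n + 1) (sigma Fq F s Q a) = thetaJet Fq C s Q n a := by
  unfold thetaJet
  rw [thetaVec_sigma]

theorem thetaJet_smul (n : ℕ) (x : F) (a : Fin (k + 1) → F[X]) :
    thetaJet Fq C s Q n (x • a) =
      algebraMap F C x ^ (Fintype.card Fq ^ n) • thetaJet Fq C s Q n a := by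
  have hsmul : x • a = Polynomial.C x • a := funext fun i => Polynomial.smul_eq_C_mul x
  funext l
  rw [thetaJet, hsmul, thetaVec_smul, polyTwist_C, Pi.smul_apply, smul_eq_mul, jet_single_zero_mul]
  rfl

end ThetaVec

section FunctionalEquation

variable {Fq : Type*} [Field Fq] [Fintype Fq] {F : Type*} [Field F] [Algebra (RatFunc Fq) F]
  [IsAlgClosed F] {C : Type*} [NormedField C] [Algebra (RatFunc Fq) C] [Algebra F C]
  [IsScalarTower (RatFunc Fq) F C] {k : ℕ} {s : Fin (k + 1) → ℕ+} {Q : Fin k → F[X]}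

theorem map_rhoT_zero : ((tModule Fq F s Q).rhoT 0).map (algebraMap F C) =
    theta Fq C • 1 + Matrix.of fun l m : Idx s =>
      if l.1 = m.1 ∧ (l.2 : ℕ) + 1 = m.2 then 1 else 0 := by
  have htheta : algebraMap F C (theta Fq F) = theta Fq C :=
    (IsScalarTower.algebraMap_apply (RatFunc Fq) F C _).symm
  ext l m
  have h := congrArg (algebraMap F C) (rhoTCoeff_zero Fq F s Q l m)
  rw [Matrix.sub_apply, map_sub, sub_eq_iff_eq_add'] at h
  refine h.trans (congrArg₂ (· + ·) ?_ ?_)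
  · simp [Matrix.one_apply, apply_ite (algebraMap F C), htheta]
  · simp [apply_ite (algebraMap F C)]

theorem map_rhoT_zero_mulVec (v : Idx s → C) (l : Idx s) :
    (((tModule Fq F s Q).rhoT 0).map (algebraMap F C) *ᵥ v) l = theta Fq C * v l +
      if h : (l.2 : ℕ) + 1 < dSum s l.1 then v ⟨l.1, ⟨l.2 + 1, h⟩⟩ else 0 := by
  rw [map_rhoT_zero, Matrix.add_mulVec, Matrix.smul_mulVec, Matrix.one_mulVec, Pi.add_apply]
  refine congrArg (theta Fq C * v l + ·) ?_
  simp only [Matrix.mulVec, dotProduct, Matrix.of_apply, ite_mul, one_mul, zero_mul]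
  split_ifs with h
  · rw [Finset.sum_eq_single ⟨l.1, ⟨l.2 + 1, h⟩⟩, if_pos ⟨rfl, rfl⟩]
    · rintro ⟨i, j⟩ _ hne
      refine if_neg ?_
      rintro ⟨rfl, hj⟩
      exact hne (Sigma.ext rfl (heq_of_eq (Fin.ext hj.symm)))
    · simp
  · refine Finset.sum_eq_zero fun m _ => if_neg ?_
    rintro ⟨hm, hj⟩
    have hlt := m.2.2
    rw [← hj, ← hm] at hlt
    exact h hlt

open scoped Matrix.Norms.Elementwise in
theorem norm_rhoT_zero_sub_le_one :
    ‖((tModule Fq F s Q).baseChange C).rhoT 0 - theta Fq C • 1‖ ≤ 1 := by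
  rw [TModule.baseChange_rhoT, map_rhoT_zero, add_sub_cancel_left, Matrix.norm_le_iff zero_le_one]
  intro l m
  rw [Matrix.of_apply]
  split_ifs <;> simp

variable [IsUltrametricDist C] [CompleteSpace C]

theorem thetaJet_zero_sigma (hθ : 1 < ‖theta Fq C‖) (a : Fin (k + 1) → F[X]) :
    thetaJet Fq C s Q 0 (sigma Fq F s Q a) = 0 := by
  have hR : ‖theta Fq C‖ < ‖theta Fq C‖ + 1 := lt_add_one _
  funext l
  obtain ⟨b, hb⟩ := dvd_sigma Fq F s Q a l.1
  have hbT : InTate Fq C (polyTwist Fq F C 0 b) :=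
    (gaussBound_polyTwist (hθ.trans hR).le 0 b).inTate hR
  rw [thetaJet, thetaVec_zero, Function.comp_apply, hb, map_mul, map_pow, polyTwist_tSubTheta,
    pow_zero, pow_one, jet_sub_theta_pow_mul hθ.le hbT, Pi.zero_apply]
  exact if_neg (by have := l.2.2; omega)

theorem logCoeff_zero (hθ : 1 < ‖theta Fq C‖) : logCoeff Fq C s Q 0 = 1 := by
  have hone : InTate Fq C (1 : LaurentSeries C) := GaussBound.one.inTate (lt_add_one _)
  ext ⟨i, l⟩ ⟨j, m⟩
  rw [logCoeff_apply, thetaJet, thetaVec_sigmaBasis, thetaProd_zero]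
  rcases eq_or_ne i j with rfl | hij
  · rw [Matrix.one_apply_eq, mul_comm, polyTwist_tSubTheta, pow_zero, pow_one,
      jet_sub_theta_pow_mul hθ.le hone, jet_one, ← ite_and, Matrix.one_apply]
    refine if_congr ?_ rfl rfl
    simp only [Sigma.mk.injEq, heq_eq_eq, true_and, Fin.ext_iff]
    omega
  · rw [Matrix.one_apply_ne hij, zero_mul, jet_zero_right, Matrix.one_apply_ne]
    exact fun h => hij (congrArg Sigma.fst h)

variable (hθ : 1 < ‖theta Fq C‖)
  (hQ : ∀ j, ((Q j).map (algebraMap F C)).gaussNorm (NormedField.toAbsoluteValue C) 1 ≤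
    carlitzPeriodNorm Fq C ^ (s j.castSucc : ℕ))
include hθ hQ

omit [CompleteSpace C] in
theorem inTate_thetaVec (n : ℕ) (a : Fin (k + 1) → F[X]) (i : Fin (k + 1)) :
    InTate Fq C (thetaVec Fq C s Q n a i) := by
  have hR0 : 0 < ‖theta Fq C‖ ^ Fintype.card Fq := pow_pos (zero_lt_one.trans hθ) _
  have hR : ‖theta Fq C‖ < ‖theta Fq C‖ ^ Fintype.card Fq :=
    lt_self_pow₀ hθ Fintype.one_lt_card
  refine Finset.sum_induction _ (InTate Fq C) (fun _ _ => InTate.add)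
    ((GaussBound.zero le_rfl).inTate hR) fun j _ => ?_
  exact ((gaussBound_thetaProd hθ hQ n i j).mul hR0
    (gaussBound_polyTwist (hθ.trans hR).le n (a j))).inTate hR

omit [CompleteSpace C] in
theorem inTate_logMatrix (n : ℕ) (l m : Idx s) : InTate Fq C (logMatrix Fq F C s Q n l m) := by
  rw [logMatrix_apply]
  exact (inTate_thetaVec hθ hQ n _ _).hasseDeriv hθ.le _

theorem thetaJet_add (n : ℕ) (a b : Fin (k + 1) → F[X]) :
    thetaJet Fq C s Q n (a + b) = thetaJet Fq C s Q n a + thetaJet Fq C s Q n b := by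
  funext l
  rw [thetaJet, map_add]
  exact jet_add hθ.le (inTate_thetaVec hθ hQ n a _) (inTate_thetaVec hθ hQ n b _) _

theorem thetaJet_X_smul (n : ℕ) (a : Fin (k + 1) → F[X]) :
    thetaJet Fq C s Q n ((X : F[X]) • a) =
      ((tModule Fq F s Q).rhoT 0).map (algebraMap F C) *ᵥ thetaJet Fq C s Q n a := by
  funext ⟨i, l⟩
  have hT := inTate_thetaVec hθ hQ n a i
  rw [map_rhoT_zero_mulVec, thetaJet, thetaVec_smul, polyTwist_X, Pi.smul_apply, smul_eq_mul]
  simp only [thetaJet]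
  split_ifs with h
  · obtain ⟨e, he⟩ := Nat.exists_eq_add_of_lt h
    rw [show dSum s i - 1 - l = e + 1 by omega, show dSum s i - 1 - (l + 1) = e by omega,
      jet_succ_laurentT_mul hθ.le hT]
  · rw [show dSum s i - 1 - l = 0 by omega, jet_zero_laurentT_mul hT, add_zero]

theorem thetaJet_sum_smul_sigmaBasis (n : ℕ) (x : Idx s → F) :
    thetaJet Fq C s Q n (∑ m, x m • sigmaBasis Fq F s m) =
      logCoeff Fq C s Q n *ᵥ fun m => algebraMap F C (x m) ^ (Fintype.card Fq ^ n) := by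
  let J : (Fin (k + 1) → F[X]) →+ (Idx s → C) :=
    AddMonoidHom.mk' (thetaJet Fq C s Q n) (thetaJet_add hθ hQ n)
  refine (map_sum J _ _).trans (funext fun l => ?_)
  rw [Finset.sum_apply]
  refine Finset.sum_congr rfl fun m _ => ?_
  change thetaJet Fq C s Q n (x m • _) l = logCoeff Fq C s Q n l m * _
  rw [thetaJet_smul, logCoeff_apply, mul_comm]
  rfl

theorem thetaJet_sigmaComb (n : ℕ) (b : Idx s → ℕ →₀ F) :
    thetaJet Fq C s Q n (sigmaComb Fq F s Q b) =
      ∑ p ∈ antidiagonal n, logCoeff Fq C s Q p.1 *ᵥ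
        fun m => algebraMap F C (b m p.2) ^ (Fintype.card Fq ^ n) := by
  induction n generalizing b with
  | zero =>
    rw [sigmaComb_eq, thetaJet_add hθ hQ, thetaJet_zero_sigma hθ, add_zero,
      thetaJet_sum_smul_sigmaBasis hθ hQ]
    simp
  | succ n ih =>
    rw [sigmaComb_eq, thetaJet_add hθ hQ, thetaJet_succ_sigma, ih,
      thetaJet_sum_smul_sigmaBasis hθ hQ, Finset.Nat.sum_antidiagonal_succ']
    refine congrArg₂ (· + ·) rfl (Finset.sum_congr rfl fun p _ => ?_)
    refine congrArg (logCoeff Fq C s Q p.1 *ᵥ ·) (funext fun m => ?_)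
    change algebraMap F C (frobEquiv Fq F (b m (p.2 + 1))) ^ _ = _
    rw [frobEquiv_apply, map_pow, ← pow_mul, ← pow_succ']

theorem single_rhoT_zero_skewMul_logCoeff :
    skewMul (matrixFrob Fq C (Idx s))
        (Pi.single 0 (((tModule Fq F s Q).baseChange C).rhoT 0)) (logCoeff Fq C s Q) =
      skewMul (matrixFrob Fq C (Idx s)) (logCoeff Fq C s Q)
        ((tModule Fq F s Q).baseChange C).rhoT := by
  ext n l m
  have hcolumn : (((tModule Fq F s Q).baseChange C).rhoT 0 * logCoeff Fq C s Q n) l m =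
      thetaJet Fq C s Q n ((X : F[X]) • sigmaBasis Fq F s m) l := by
    rw [thetaJet_X_smul hθ hQ, Matrix.mul_apply]
    exact Finset.sum_congr rfl fun j _ => by rw [logCoeff_apply]; rfl
  rw [single_zero_skewMul, hcolumn, ← sigmaComb_iota Fq F s Q ((X : F[X]) • _),
    thetaJet_sigmaComb hθ hQ, skewMul, Matrix.sum_apply, Finset.sum_apply]
  refine Finset.sum_congr rfl fun ⟨i, j⟩ hij => ?_
  obtain rfl := mem_antidiagonal.1 hij
  refine Finset.sum_congr rfl fun l' _ => congrArg (_ * ·) ?_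
  rw [matrixFrob_pow_apply]
  change _ = frob Fq C i (algebraMap F C (_ ^ (Fintype.card Fq ^ j)))
  rw [frob_apply, map_pow, ← pow_mul, ← pow_add, add_comm j]

end FunctionalEquation

section Convergence

variable {Fq : Type*} [Field Fq] [Fintype Fq] {F : Type*} [Field F] [Algebra (RatFunc Fq) F]
  [IsAlgClosed F] {C : Type*} [NormedField C] [Algebra (RatFunc Fq) C] [Algebra F C]
  [IsScalarTower (RatFunc Fq) F C] {k : ℕ} {s : Fin (k + 1) → ℕ+} {Q : Fin k → F[X]}
  [IsUltrametricDist C] (hθ : 1 < ‖theta Fq C‖)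
  (hQ : ∀ j, ((Q j).map (algebraMap F C)).gaussNorm (NormedField.toAbsoluteValue C) 1 ≤
    carlitzPeriodNorm Fq C ^ (s j.castSucc : ℕ))
include hθ hQ

theorem norm_logCoeff_succ_le (n : ℕ) (l m : Idx s) :
    ‖logCoeff Fq C s Q (n + 1) l m‖ ≤
      thetaWeight Fq C s Q (n + 1) m.1 / thetaWeight Fq C s Q 0 l.1 *
        ‖theta Fq C ^ (Fintype.card Fq ^ (n + 1))‖ ^ (dSum s m.1 - 1 - m.2) := by
  have hR0 : 0 < ‖theta Fq C‖ ^ Fintype.card Fq := pow_pos (zero_lt_one.trans hθ) _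
  have hR : ‖theta Fq C‖ ^ Fintype.card Fq ≤ ‖theta Fq C ^ (Fintype.card Fq ^ (n + 1))‖ := by
    rw [norm_pow]
    exact pow_le_pow_right₀ hθ.le (Nat.le_self_pow (Nat.succ_ne_zero n) _)
  rw [logCoeff_apply, thetaJet, thetaVec_sigmaBasis, polyTwist_tSubTheta]
  exact ((gaussBound_thetaProd hθ hQ (n + 1) l.1 m.1).mul hR0
    ((gaussBound_laurentT_sub_single hR0.le hR).pow hR0 _)).norm_jet_le (one_le_pow₀ hθ.le)
    (le_self_pow₀ hθ.le Fintype.card_ne_zero) _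

theorem tendsto_logCoeff_mul (l m : Idx s) {x : C}
    (hx : ‖theta Fq C‖ ^ (dSum s m.1 - 1 - m.2) * ‖x‖ < carlitzPeriodNorm Fq C ^ dSum s m.1) :
    Tendsto (fun n => logCoeff Fq C s Q n l m * x ^ (Fintype.card Fq ^ n)) atTop (𝓝 0) := by
  have hγ := carlitzPeriodNorm_pos hθ
  rw [← tendsto_add_atTop_iff_nat 1]
  set K := (‖theta Fq C‖ ^ Fintype.card Fq) ^
    ((Finset.univ.sup fun i => (Q i).natDegree) * (m.1 : ℕ)) / thetaWeight Fq C s Q 0 l.1 with hK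
  set ρ := ‖theta Fq C‖ ^ (dSum s m.1 - 1 - m.2) * ‖x‖ / carlitzPeriodNorm Fq C ^ dSum s m.1 with hρ
  have hlim : Tendsto (fun n => K * ρ ^ (Fintype.card Fq ^ (n + 1))) atTop (𝓝 0) := by
    have hρ1 := tendsto_pow_atTop_nhds_zero_of_lt_one (show 0 ≤ ρ by positivity)
      ((div_lt_one (by positivity)).2 hx)
    simpa using ((hρ1.comp (tendsto_pow_atTop_atTop_of_one_lt Fintype.one_lt_card)).comp
      (tendsto_add_atTop_nat 1)).const_mul K
  refine squeeze_zero_norm (fun n => ?_) hlim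
  rw [norm_mul, norm_pow]
  have hle := norm_logCoeff_succ_le hθ hQ n l m
  refine (mul_le_mul_of_nonneg_right hle (by positivity)).trans_eq ?_
  rw [hK, hρ, thetaWeight, norm_pow, pow_right_comm _ (Fintype.card Fq ^ (n + 1)), div_pow, mul_pow]
  ring

theorem tendsto_twistedMulVec_logCoeff {c : Idx s → C} (hc : ∀ m,
    ‖theta Fq C‖ ^ (dSum s m.1 - 1 - m.2) * ‖c m‖ < carlitzPeriodNorm Fq C ^ dSum s m.1) :
    Tendsto (fun n => twistedMulVec Fq (logCoeff Fq C s Q n) n c) atTop (𝓝 0) := by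
  refine tendsto_pi_nhds.2 fun l => ?_
  rw [Pi.zero_apply, ← Finset.sum_const_zero (s := (Finset.univ : Finset (Idx s)))]
  exact tendsto_finsetSum _ fun m _ => tendsto_logCoeff_mul hθ hQ l m (hc m)

end Convergence

theorem isUltrametricDist_of_ringHom {k C : Type*} [Field k] [Finite k] [NormedField C]
    (f : k →+* C) : IsUltrametricDist C := by
  have := Fintype.ofFinite k
  refine IsUltrametricDist.isUltrametricDist_of_forall_norm_natCast_le_one fun n => ?_
  have hpow : ‖(n : C)‖ ^ Fintype.card k = ‖(n : C)‖ := by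
    rw [← norm_pow, ← map_natCast f, ← map_pow, FiniteField.pow_card]
  exact le_of_not_gt fun hn => (lt_self_pow₀ hn Fintype.one_lt_card).ne' hpow

theorem norm_theta_CInfty (Fq : Type*) [Field Fq] [Fintype Fq] :
    ‖theta Fq (CInfty Fq)‖ = Fintype.card Fq := by
  change ‖algebraMap (KInfty Fq) (CInfty Fq) (algebraMap (RatFunc Fq) (KInfty Fq) RatFunc.X)‖ = _
  rw [norm_algebraMap', KInfty.norm_algebraMap, absInfty_X]

theorem norm_theta_pow_mul_lt {Fq C : Type*} [Field Fq] [Fintype Fq] [NormedField C]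
    [Algebra (RatFunc Fq) C] {k : ℕ} {s : Fin (k + 1) → ℕ+} (hθ : 1 < ‖theta Fq C‖)
    {m : Idx s} {x : C} (hx : ‖x‖ < ‖theta Fq C‖ ^
      (((m.2 : ℕ) : ℝ) + 1 + (dSum s m.1 : ℝ) / ((Fintype.card Fq : ℝ) - 1))) :
    ‖theta Fq C‖ ^ (dSum s m.1 - 1 - m.2) * ‖x‖ < carlitzPeriodNorm Fq C ^ dSum s m.1 := by
  have hθ0 : 0 < ‖theta Fq C‖ := zero_lt_one.trans hθ
  have hq : (Fintype.card Fq : ℝ) - 1 ≠ 0 :=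
    (sub_pos.2 (by exact_mod_cast Fintype.one_lt_card)).ne'
  have hexp : ((dSum s m.1 - 1 - m.2 : ℕ) : ℝ) = dSum s m.1 - 1 - (m.2 : ℕ) := by
    rw [Nat.sub_sub, Nat.cast_sub (by have := m.2.2; omega)]
    push_cast
    ring
  refine (mul_lt_mul_of_pos_left hx (pow_pos hθ0 _)).trans_eq ?_
  rw [carlitzPeriodNorm_pow, ← Real.rpow_natCast, ← Real.rpow_add hθ0, hexp]
  congr 1
  field_simp
  ring

end TMot

theorem lemmaL_general {Fq : Type*} [Field Fq] [Fintype Fq]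
    {F : Type*} [Field F] [Algebra (RatFunc Fq) F] [IsAlgClosed F]
    {C : Type*} [NormedField C] [CompleteSpace C] [Algebra (RatFunc Fq) C] [Algebra F C]
    [IsScalarTower (RatFunc Fq) F C] (hθ : 1 < ‖theta Fq C‖)
    {k : ℕ} (s : Fin (k + 1) → ℕ+) (Q : Fin k → F[X])
    (hQ : ∀ i : Fin k,
      ((Q i).map (algebraMap F C)).gaussNorm (NormedField.toAbsoluteValue C) 1 ≤
        ‖theta Fq C‖ ^
          (((s i.castSucc : ℕ) : ℝ) * (Fintype.card Fq : ℝ) / ((Fintype.card Fq : ℝ) - 1)))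
    (c : Idx s → C)
    (hc : ∀ (i : Fin (k + 1)) (j : Fin (dSum s i)),
      ‖c ⟨i, j⟩‖ < ‖theta Fq C‖ ^
        (((j : ℕ) : ℝ) + 1 + (dSum s i : ℝ) / ((Fintype.card Fq : ℝ) - 1))) :
    (∀ n l m, InTate Fq C (logMatrix Fq F C s Q n l m)) ∧
    Summable (logTerm Fq F C s Q c) ∧
    Summable ((tModule Fq F s Q).expTerm (∑' n, logTerm Fq F C s Q c n)) ∧
    (tModule Fq F s Q).Exp (∑' n, logTerm Fq F C s Q c n) = c := by
  have : IsUltrametricDist C :=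
    isUltrametricDist_of_ringHom ((algebraMap (RatFunc Fq) C).comp (algebraMap Fq (RatFunc Fq)))
  replace hQ (i : Fin k) := (hQ i).trans_eq (carlitzPeriodNorm_pow _).symm
  have hlog : Filter.Tendsto (logTerm Fq F C s Q c) Filter.atTop (nhds 0) :=
    tendsto_twistedMulVec_logCoeff hθ hQ fun m => norm_theta_pow_mul_lt hθ (hc m.1 m.2)
  have hexp : HasSum ((tModule Fq F s Q).expTerm (∑' n, logTerm Fq F C s Q c n)) c :=
    TModule.hasSum_expTerm_tsum_twistedMulVec hθ ((norm_rhoT_zero_sub_le_one).trans_lt hθ)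
      (logCoeff_zero hθ) (single_rhoT_zero_skewMul_logCoeff hθ hQ) hlog
  refine ⟨inTate_logMatrix hθ hQ, ?_, hexp.summable, hexp.tsum_eq⟩
  exact NonarchimedeanAddGroup.summable_of_tendsto_cofinite_zero
    (by rwa [Nat.cofinite_eq_atTop])

theorem lemmaL (Fq : Type*) [Field Fq] [Fintype Fq]
    (𝕂 : IntermediateField (RatFunc Fq) (CInfty Fq)) [IsAlgClosed 𝕂]
    (k : ℕ) (s : Fin (k + 1) → ℕ+) (Q : Fin k → 𝕂[X])
    (hQ : ∀ i : Fin k,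
      ((Q i).map (algebraMap 𝕂 (CInfty Fq))).gaussNorm
          (NormedField.toAbsoluteValue (CInfty Fq)) 1 ≤
        (Fintype.card Fq : ℝ) ^
          (((s i.castSucc : ℕ) : ℝ) * (Fintype.card Fq : ℝ) / ((Fintype.card Fq : ℝ) - 1)))
    (c : Idx s → CInfty Fq)
    (hc : ∀ (i : Fin (k + 1)) (j : Fin (dSum s i)),
      ‖c ⟨i, j⟩‖ < (Fintype.card Fq : ℝ) ^
        (((j : ℕ) : ℝ) + 1 + (dSum s i : ℝ) / ((Fintype.card Fq : ℝ) - 1))) :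
    (∀ n l m, InTate Fq (CInfty Fq) (logMatrix Fq 𝕂 (CInfty Fq) s Q n l m)) ∧
    Summable (logTerm Fq 𝕂 (CInfty Fq) s Q c) ∧
    Summable ((tModule Fq 𝕂 s Q).expTerm (∑' n, logTerm Fq 𝕂 (CInfty Fq) s Q c n)) ∧
    (tModule Fq 𝕂 s Q).Exp (∑' n, logTerm Fq 𝕂 (CInfty Fq) s Q c n) = c := by
  have hθ := norm_theta_CInfty Fq
  have hcard : 1 < (Fintype.card Fq : ℝ) := by exact_mod_cast Fintype.one_lt_card
  exact lemmaL_general (hcard.trans_eq hθ.symm) s Q (by rwa [hθ]) c (by rwa [hθ])
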